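/- \textbf{Setting.} Let $E$ be a ground set of $n\ge 1$ elements, let $f:2^E\to\mathbb R_{\ge 0}$ be submodular, i.e. $f(S\cup\{i\})-f(S)\ge f(T\cup\{i\})-f(T)$ whenever $S\subseteq T\subseteq E$ and $i\in E\setminus T$ ($f$ need be neither monotone nor symmetric), and let $k\ge 1$. The problem is $\max\{f(X): X\subseteq E,\ |X|\le k\}$, where $f$ is given by a value oracle. Write $f(e|S)=f(S\cup\{e\})-f(S)$, and let $\log$ be the natural logarithm. \textbf{Algorithm} $\mathrm{FPT}^+(f,E,k,\varepsilon,T)$, for an integer $T\ge 0$ and a real $0<\varepsilon\le 1$. First, dummy elements, which do not change the value of any set, are added to $E$: with $w=\lceil \varepsilon(n+(T+1)k)/(3k)\rceil$, the padded set, again called $E$, has $\lceil 3kw/\varepsilon\rceil$ elements. (So there are at least $(T+1)k$ dummies, and $\lfloor\varepsilon|E|\rfloor=3kw$.) Then: 1. (\textsc{SymmetricStream}.) Put $E$ in uniformly random order. Divide the first $\varepsilon$ fraction into $3k$ consecutive windows $w_1,\dots,w_{3k}$ of equal size. Let $S_0=\emptyset$, and for $i=1,\dots,3k$ let $e_i\in\arg\max_{e\in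 w_i}f(e|S_{i-1})$ and $S_i=S_{i-1}\cup\{e_i\}$. Let $H=\emptyset$; for each $e\in E\setminus(w_1\cup\dots\cup w_{3k})$ in stream order and each $i=1,\dots,3k$, add $e$ to $H$ if $f(e|S_{i-1})>f(e_i|S_{i-1})$ and $|H|<18k^2\log k/\varepsilon$. Finally compute by exhaustive search $\arg\max\{f(X):X\subseteq S_{3k}\cup H,\ |X|\le k\}$. Only $S_{3k}$ and $H$ are kept. 2. Return the result of $\textsc{Recursive}(S_{3k}\cup H,\,1)$, without its dummy elements. $\textsc{Recursive}(I,t)$: start with $X^*=\emptyset$. For each $G\subseteq I$ with $|G|\le k$, do the following. Start with $I'=\emptyset$; for $i=1,\dots,T$, run the greedy algorithm with initial solution $G$ on the current $E$ (repeatedly add an element $e$ not yet in the solution $X$ that maximizes $f(e|X)$) until the solution $G\cup X_i$ has $k$ elements, add $X_i$ to $I'$, and remove $X_i$ from $E$. Then put $I'$ back into $E$. If $t\le T$, let $X'$ be the result of $\textsc{Recursive}(I\cup I',\,t+1)$, and replace $X^*$ by $X'$ if $f(X')>f(X^*)$; otherwise let $X^*\in\arg\max\{f(X):X\subseteq I,\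 |X|\le k\}$, found by exhaustive search. Finally return $X^*$. \textbf{Costs.} The query complexity is the number of oracle calls. The runtime counts elementary steps: querying a set $X$ costs $O(|X|+1)$; a comparison or arithmetic operation on oracle values, a comparison of two elements, a step along a list, and the drawing of a uniformly random number from $\{0,\dots,m\}$ cost $O(1)$ each. (Sets are kept as lists, and the random order is produced by a Fisher–Yates shuffle.) A function $g$ is $\widetilde O(k)$ if $g(k)=O(k\log^c k)$ as $k\to\infty$ for some constant $c$. \textbf{Theorem.} (i) There are constants $T_0\in\mathbb N$ and $\varepsilon_0\in(0,1]$ such that, for all integers $T\ge T_0$, all $0<\varepsilon\le\varepsilon_0$, all $n,k\ge 1$, and every non-negative submodular $f$ on an $n$-element ground set, the random set $X$ returned by $\mathrm{FPT}^+(f,E,k,\varepsilon,T)$ satisfies $$\mathbb E[f(X)]\ \ge\ 0.539\cdot\max_{O\subseteq E,\ |O|\le k}f(O).$$ (ii) For every fixed integer $T\ge 0$ and every fixed $0<\varepsilon\le 1$ there is a function $g(k)=\widetilde O(k)$ such that, for all $n,k\ge 1$ and every oracle $f$, in every execution the returned set $X$ satisfies $|X|\le k$, and both the number of queries and the runtime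 are at most $2^{g(k)}\cdot n$. -/

import Mathlib

noncomputable section

namespace SubmodularFPT

/-- Submodularity of a set function on the subsets of the `n`-element ground set `Fin n`
(diminishing marginal gains). -/
def IsSubmodular {n : ℕ} (f : Finset (Fin n) → ℝ) : Prop :=
  ∀ S T : Finset (Fin n), S ⊆ T → ∀ i, i ∉ T →
    f (insert i T) - f T ≤ f (insert i S) - f S

/-- `g(k) = Õ(k)`, that is, `g(k) = O(k · (log k)^c)` for some constant `c`. -/
def IsSoftOLinear (g : ℕ → ℝ) : Prop :=
  ∃ c : ℕ, g =O[Filter.atTop] fun k : ℕ => (k : ℝ) * Real.log k ^ c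

/-! ### Randomized algorithms with a value oracle, and their costs -/

/-- A randomized algorithm over the ground set `Fin n` with output in `α`. It can stop with an
output, perform an elementary step, ask the value oracle for the value of a subset of the ground
set, or draw a uniformly random element of `{0, …, m}`. The value oracle is accessible
only through `query`. -/
inductive Alg (n : ℕ) (α : Type) : Type
  | ret (a : α) : Alg n α
  | step (p : Alg n α) : Alg n α
  | query (X : Finset (Fin n)) (p : ℝ → Alg n α) : Alg n α
  | rand (m : ℕ) (p : Fin (m + 1) → Alg n α) : Alg n α

/-- Sequential composition. -/
def Alg.bind {n : ℕ} {α β : Type} : Alg n α → (α → Alg n β) → Alg n β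
  | .ret a, q => q a
  | .step p, q => .step (p.bind q)
  | .query X p, q => .query X fun v => (p v).bind q
  | .rand m p, q => .rand m fun j => (p j).bind q

instance (n : ℕ) : Monad (Alg n) where
  pure := Alg.ret
  bind := Alg.bind

/-- What is observed of one execution: the output, the number of oracle queries, and the running
time. -/
structure Outcome (α : Type) where
  output : α
  queries : ℕ
  time : ℕ

/-- The distribution of the outcome of an algorithm when its value oracle is `f`. An elementary
step and a random draw take one unit of time; querying `X` counts as one query
and takes `|X| + 1` units of time. -/
def Alg.run {n : ℕ} (f : Finset (Fin n) → ℝ) {α : Type} : Alg n α → PMF (Outcome α)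
  | .ret a => PMF.pure ⟨a, 0, 0⟩
  | .step p => (p.run f).map fun o => ⟨o.output, o.queries, o.time + 1⟩
  | .query X p =>
      ((p (f X)).run f).map fun o => ⟨o.output, o.queries + 1, o.time + (X.card + 1)⟩
  | .rand m p => ((PMF.uniformOfFintype (Fin (m + 1))).bind fun j => (p j).run f).map
      fun o => ⟨o.output, o.queries, o.time + 1⟩

/-- The expected value `𝔼[f(X)]` of the set `X` that an algorithm outputs (for non-negative `f`). -/
def Alg.expectedValue {n : ℕ} (f : Finset (Fin n) → ℝ) (A : Alg n (Finset (Fin n))) : ENNReal :=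
  ∑' o : Outcome (Finset (Fin n)), A.run f o * ENNReal.ofReal (f o.output)

/-- Spend `m` units of time. -/
def tick {n : ℕ} : ℕ → Alg n Unit
  | 0 => .ret ()
  | m + 1 => .step (tick m)

/-! ### Elements, sets as lists

Every traversal of a list is charged at least one unit of time per entry that is visited, and every
comparison of two real numbers or of two elements is charged. -/

/-- The ground set, padded with dummy elements: `Sum.inl` marks the elements of the original ground
set and `Sum.inr` the dummy elements. -/
abbrev Elt (n : ℕ) : Type := Fin n ⊕ ℕ

/-- The set of the non-dummy elements in a list. -/
def realPart {n : ℕ} (X : List (Elt n)) : Finset (Fin n) :=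
  (X.filterMap Sum.getLeft?).toFinset

/-- The value `f(X)`, where the dummy elements in `X` do not contribute. -/
def value {n : ℕ} (X : List (Elt n)) : Alg n ℝ := do
  tick X.length
  .query (realPart X) .ret

/-- The marginal gain `f(e | X) = f(X ∪ {e}) - f(X)`. -/
def marginal {n : ℕ} (X : List (Elt n)) (e : Elt n) : Alg n ℝ := do
  let a ← value (e :: X)
  let b ← value X
  tick 1
  pure (a - b)

/-- Membership test by linear search. -/
def mem {n : ℕ} (e : Elt n) : List (Elt n) → Alg n Bool
  | [] => do
      tick 1
      pure false
  | y :: ys => do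
      tick 1
      if e = y then pure true else mem e ys

/-- Set difference `E \ X`. -/
def without {n : ℕ} (X : List (Elt n)) : List (Elt n) → Alg n (List (Elt n))
  | [] => do
      tick 1
      pure []
  | e :: E => do
      let b ← mem e X
      let R ← without X E
      tick 1
      pure (if b then R else e :: R)

/-- Union `I ∪ J` of two sets. -/
def union {n : ℕ} (I J : List (Elt n)) : Alg n (List (Elt n)) := do
  let R ← without I J
  tick (R.length + 1)
  pure (R ++ I)

/-- An entry of maximum value among `best` (of value `bestVal`) and the entries of a list. -/
def argmaxFrom {n : ℕ} {β : Type} (val : β → Alg n ℝ) (best : β) (bestVal : ℝ) :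
    List β → Alg n β
  | [] => do
      tick 1
      pure best
  | y :: ys => do
      let v ← val y
      tick 1
      if bestVal < v then argmaxFrom val y v ys else argmaxFrom val best bestVal ys

/-- An entry of maximum value in a list (`none` if the list is empty). -/
def argmax {n : ℕ} {β : Type} (val : β → Alg n ℝ) : List β → Alg n (Option β)
  | [] => do
      tick 1
      pure none
  | y :: ys => do
      let v ← val y
      let r ← argmaxFrom val y v ys
      tick 1
      pure (some r)

/-- The list of all subsets of size at most `k` of a set. -/
def subsets {n : ℕ} : ℕ → List (Elt n) → Alg n (List (List (Elt n)))
  | 0, _ => do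
      tick 1
      pure [[]]
  | _ + 1, [] => do
      tick 1
      pure [[]]
  | k + 1, x :: xs => do
      let A ← subsets k xs
      let B ← subsets (k + 1) xs
      tick (2 * A.length + 1)
      pure (A.map (fun Y => x :: Y) ++ B)

/-- Exhaustive search for `argmax {f(X) : X ⊆ I, |X| ≤ k}`. -/
def bruteForce {n : ℕ} (k : ℕ) (I : List (Elt n)) : Alg n (List (Elt n)) := do
  let L ← subsets k I
  let r ← argmax value L
  pure (r.getD [])

/-! ### The random order -/

/-- Fisher–Yates: for `i, i - 1, …, 1`, swap the entry at position `i - 1` with the entry at a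
uniformly random position in `{0, …, i - 1}`. -/
def shuffleFrom {n : ℕ} : ℕ → Array (Elt n) → Alg n (Array (Elt n))
  | 0, a => pure a
  | i + 1, a => .rand i fun j => .step (shuffleFrom i (a.swapIfInBounds i j))

/-- A uniformly random permutation of a list. -/
def shuffle {n : ℕ} (E : List (Elt n)) : Alg n (List (Elt n)) := do
  tick E.length
  let a ← shuffleFrom E.length E.toArray
  tick E.length
  pure a.toList

/-! ### The core algorithm `SymmetricStream` -/

/-- The first loop, with `i` windows of size `w` to go on the given stream and with current
solution `S`. It returns the final solution, the list of the pairs `(S_{i-1}, e_i)`,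
and the part of the stream that follows the windows. -/
def selectWindows {n : ℕ} (w : ℕ) : ℕ → List (Elt n) → List (Elt n) →
    Alg n (List (Elt n) × List (List (Elt n) × Elt n) × List (Elt n))
  | 0, stream, S => do
      tick 1
      pure (S, [], stream)
  | i + 1, stream, S => do
      tick (w + 1)
      let r ← argmax (marginal S) (stream.take w)
      match r with
      | none => selectWindows w i (stream.drop w) S
      | some e =>
          let t ← selectWindows w i (stream.drop w) (e :: S)
          pure (t.1, (S, e) :: t.2.1, t.2.2)

/-- The treatment of one element `e` of the rest of the stream: for each pair `(S_{i-1}, e_i)`, if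
`f(e | S_{i-1}) > f(e_i | S_{i-1})` and `|H| < thr`, then `e` is added to `H`. -/
def scanElement {n : ℕ} (thr : ℝ) (e : Elt n) :
    List (List (Elt n) × Elt n) → List (Elt n) → Alg n (List (Elt n))
  | [], H => do
      tick 1
      pure H
  | (S, a) :: P, H => do
      let x ← marginal S e
      let y ← marginal S a
      tick (H.length + 2)
      if y < x ∧ (H.length : ℝ) < thr then
        let J ← union H [e]
        scanElement thr e P J
      else
        scanElement thr e P H

/-- The second loop, over the rest of the stream. -/
def scanStream {n : ℕ} (thr : ℝ) (P : List (List (Elt n) × Elt n)) :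
    List (Elt n) → List (Elt n) → Alg n (List (Elt n))
  | [], H => do
      tick 1
      pure H
  | e :: stream, H => do
      tick 1
      let J ← scanElement thr e P H
      scanStream thr P stream J

/-- `SymmetricStream(f, E, k, ε)` on `E` in uniformly random order; it returns `S_{3k}`, `H`, and
the best solution found. The first `ε` fraction of the stream, which has `⌊ε|E|⌋` elements, is
divided into `3k` windows. -/
def symmetricStream {n : ℕ} (E : List (Elt n)) (k : ℕ) (ε : ℝ) :
    Alg n (List (Elt n) × List (Elt n) × List (Elt n)) := do
  let stream ← shuffle E
  tick E.length
  let r ← selectWindows (⌊ε * E.length⌋₊ / (3 * k)) (3 * k) stream []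
  let H ← scanStream (18 * (k : ℝ) ^ 2 * Real.log k / ε) r.2.1 r.2.2 []
  let I ← union r.1 H
  let X ← bruteForce k I
  pure (r.1, H, X)

/-! ### The recursive part -/

/-- Greedy: in each of the given number of iterations, an element of `E \ X` of maximum marginal
gain `f(e | X)` is added to the current solution `X`. It returns the list of the added elements. -/
def greedy {n : ℕ} (E : List (Elt n)) : ℕ → List (Elt n) → Alg n (List (Elt n))
  | 0, _ => do
      tick 1
      pure []
  | j + 1, X => do
      let C ← without X E
      let r ← argmax (marginal X) C
      tick 1
      match r with
      | none => pure []
      | some e =>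
          let R ← greedy E j (e :: X)
          pure (e :: R)

/-- The given number of greedy runs, each of which starts with the solution `G` and builds a
size-`k` solution `G ∪ X_i`; the set `X_i` is then added to `J` and removed from `E`. The final
version of `J` is returned. -/
def greedyRuns {n : ℕ} (k : ℕ) (G : List (Elt n)) :
    ℕ → List (Elt n) → List (Elt n) → Alg n (List (Elt n))
  | 0, _, J => do
      tick 1
      pure J
  | i + 1, E, J => do
      tick (G.length + 1)
      let X ← greedy E (k - G.length) G
      let E₁ ← without X E
      tick (X.length + 1)
      greedyRuns k G i E₁ (X ++ J)

/-- `Recursive(f, E, k, I, t, T)`, where the number `T + 1 - t` of levels of recursion that are left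
is given instead of `t`; so the case `0` is `t = T + 1`, and the case `r + 1` is `t ≤ T`. -/
def recursive {n : ℕ} (E : List (Elt n)) (k T : ℕ) : ℕ → List (Elt n) → Alg n (List (Elt n))
  | 0, I => do
      let L ← subsets k I
      L.foldlM (fun _ G => do
        tick 1
        let _ ← greedyRuns k G T E []
        bruteForce k I) []
  | r + 1, I => do
      let L ← subsets k I
      L.foldlM (fun X G => do
        tick 1
        let J ← greedyRuns k G T E []
        let K ← union I J
        let Y ← recursive E k T r K
        let a ← value Y
        let b ← value X
        tick 1
        pure (if b < a then Y else X)) []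

/-! ### The algorithm `FPT⁺` -/

/-- The common size of the `3k` windows: `ε / (3k)` times the number `n + (T + 1) k`, rounded up. -/
def windowSize (n k : ℕ) (ε : ℝ) (T : ℕ) : ℕ :=
  ⌈ε * ((n : ℝ) + (T + 1) * k) / (3 * k)⌉₊

/-- The size of the ground set after padding. It is the least number `m` such that `ε m` is at least
`3k` times the window size. For `k ≥ 1` and `0 < ε ≤ 1`, there are at least `(T + 1) k` dummy
elements, so that greedy always finds an element of non-negative marginal gain,
and the first `⌊ε m⌋` elements split evenly into `3k` non-empty windows. -/
def paddedSize (n k : ℕ) (ε : ℝ) (T : ℕ) : ℕ :=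
  ⌈3 * (k : ℝ) * windowSize n k ε T / ε⌉₊

/-- The padded ground set. -/
def groundList (n k : ℕ) (ε : ℝ) (T : ℕ) : List (Elt n) :=
  (List.finRange n).map Sum.inl ++ (List.range (paddedSize n k ε T - n)).map Sum.inr

/-- `FPT⁺(f, E, k, ε, T)` for a ground set `E` of `n` elements. -/
def fptPlus (n k : ℕ) (ε : ℝ) (T : ℕ) : Alg n (Finset (Fin n)) := do
  tick (groundList n k ε T).length
  let r ← symmetricStream (groundList n k ε T) k ε
  let I ← union r.1 r.2.1
  let X ← recursive (groundList n k ε T) k T T I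
  tick (X.length + 1)
  pure (realPart X)

end SubmodularFPT

end

/-!
The approximation ratio holds for every execution, and whatever the stream hands over to the
recursion; for large `T` it is even close to `1 - 1 / e`. Let `O` be a feasible set, and follow the
branch of the recursion in which the guess `G` is always the intersection of `O` with the current
collection `I`. The value of `O ∩ I` telescopes along the branch. So either it increases by
`f(O) / T` on each of the `T` levels, and the final exhaustive search finds a set of value at
least `f(O)`, or there is a level on which the `T` greedy runs take elements of `O` that add less than
`f(O) / T` to `G`. By submodularity, `G` and the set `D` of the elements of `O` that are still
missing then have value at least `(1 - 1 / T) f(O)` together. All elements of `D` were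
candidates in all steps of all greedy runs. The runs yield disjoint sets, and so do their
prefixes of any given length; hence the prefixes reduce the value of `G ∪ D` by at most a fraction
`1 / T` on average, although `f` is not monotone. The usual analysis of greedy for monotone functions
therefore works on average over the runs (`IsSubmodular.exists_ext_greedy_ge`), and it gives a set of
value at least `(1 - 1 / e) (1 - 1 / T) ^ 2 f(O)`, which the final exhaustive search can use
(`ensures_recursive_value`).

For the costs, all lists from which subsets are taken have length `O(k ^ 3)` for fixed `T` and `ε`.
So there are `k ^ O(k)` branches, and each of them takes time polynomial in `k` and linear in `n`
(`ensures_recursive_cost`, `ensures_fptPlus_cost`).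

Statements about executions have the form `Alg.Ensures`, a postcondition on the output and the running
time. The number of queries never exceeds the running time.
-/

noncomputable section

namespace SubmodularFPT

/-! ### Reasoning about executions -/

/-- `A.Ensures f P` says that, with value oracle `f`, every execution of `A` ends with an output `a`
and a running time `t` such that `P a t`. -/
def Alg.Ensures {n : ℕ} (f : Finset (Fin n) → ℝ) {α : Type} : Alg n α → (α → ℕ → Prop) → Prop
  | .ret a, P => P a 0
  | .step p, P => p.Ensures f fun a t => P a (t + 1)
  | .query X p, P => (p (f X)).Ensures f fun a t => P a (t + (X.card + 1))
  | .rand _ p, P => ∀ j, (p j).Ensures f fun a t => P a (t + 1)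

section Ensures

variable {n : ℕ} {f : Finset (Fin n) → ℝ} {α β γ : Type}

theorem Alg.Ensures.mono {A : Alg n α} {P Q : α → ℕ → Prop} (h : A.Ensures f P)
    (hPQ : ∀ a t, P a t → Q a t) : A.Ensures f Q := by
  induction A generalizing P Q with
  | ret a => exact hPQ _ _ h
  | step p ih => exact ih h fun a t => hPQ a _
  | query X p ih => exact ih _ h fun a t => hPQ a _
  | rand m p ih => exact fun j => ih j (h j) fun a t => hPQ a _

theorem Alg.ensures_true (A : Alg n α) : A.Ensures f fun _ _ => True := by
  induction A with
  | ret a => trivial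
  | step p ih => exact ih
  | query X p ih => exact ih _
  | rand m p ih => exact ih

theorem Alg.Ensures.of_mem_support {A : Alg n α} {P : α → ℕ → Prop} (h : A.Ensures f P) :
    ∀ o ∈ (A.run f).support, P o.output o.time := by
  induction A generalizing P with
  | ret a =>
    intro o ho
    simp only [Alg.run, PMF.support_pure, Set.mem_singleton_iff] at ho
    subst ho
    exact h
  | step p ih =>
    intro o ho
    simp only [Alg.run, PMF.mem_support_map_iff] at ho
    obtain ⟨o', ho', rfl⟩ := ho
    exact ih h o' ho'
  | query X p ih =>
    intro o ho
    simp only [Alg.run, PMF.mem_support_map_iff] at ho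
    obtain ⟨o', ho', rfl⟩ := ho
    exact ih _ h o' ho'
  | rand m p ih =>
    intro o ho
    simp only [Alg.run, PMF.mem_support_map_iff, PMF.mem_support_bind_iff] at ho
    obtain ⟨o', ⟨j, -, ho'⟩, rfl⟩ := ho
    exact ih j (h j) o' ho'

theorem Alg.queries_le_time (A : Alg n α) : ∀ o ∈ (A.run f).support, o.queries ≤ o.time := by
  induction A with
  | ret a =>
    intro o ho
    simp only [Alg.run, PMF.support_pure, Set.mem_singleton_iff] at ho
    subst ho
    exact le_rfl
  | step p ih =>
    intro o ho
    simp only [Alg.run, PMF.mem_support_map_iff] at ho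
    obtain ⟨o', ho', rfl⟩ := ho
    exact (ih o' ho').trans (Nat.le_succ _)
  | query X p ih =>
    intro o ho
    simp only [Alg.run, PMF.mem_support_map_iff] at ho
    obtain ⟨o', ho', rfl⟩ := ho
    exact Nat.add_le_add (ih _ o' ho') (Nat.le_add_left _ _)
  | rand m p ih =>
    intro o ho
    simp only [Alg.run, PMF.mem_support_map_iff, PMF.mem_support_bind_iff] at ho
    obtain ⟨o', ⟨j, -, ho'⟩, rfl⟩ := ho
    exact (ih j o' ho').trans (Nat.le_succ _)

theorem Alg.le_expectedValue {A : Alg n (Finset (Fin n))} {v : ℝ}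
    (h : A.Ensures f fun X _ => v ≤ f X) : ENNReal.ofReal v ≤ A.expectedValue f := by
  calc ENNReal.ofReal v = ∑' o, A.run f o * ENNReal.ofReal v := by
        rw [ENNReal.tsum_mul_right, PMF.tsum_coe, one_mul]
    _ ≤ A.expectedValue f := by
        refine ENNReal.tsum_le_tsum fun o => ?_
        by_cases ho : A.run f o = 0
        · simp [ho]
        · exact mul_le_mul_right (ENNReal.ofReal_le_ofReal
            (h.of_mem_support o ((PMF.mem_support_iff _ _).2 ho))) _

/-- The rule for sequential composition. -/
theorem Alg.Ensures.bind {A : Alg n α} {q : α → Alg n β} {Q : α → ℕ → Prop} {P : β → ℕ → Prop}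
    (h : A.Ensures f Q) (hq : ∀ a t, Q a t → (q a).Ensures f fun b s => P b (t + s)) :
    (A >>= q).Ensures f P := by
  change (A.bind q).Ensures f P
  induction A generalizing P Q with
  | ret a => exact (hq a 0 h).mono fun b s hb => by rwa [zero_add] at hb
  | step p ih =>
    refine ih h fun a t ha => (hq a _ ha).mono fun b s hb => ?_
    rwa [add_right_comm] at hb
  | query X p ih =>
    refine ih _ h fun a t ha => (hq a _ ha).mono fun b s hb => ?_
    rwa [add_right_comm] at hb
  | rand m p ih =>
    refine fun j => ih j (h j) fun a t ha => (hq a _ ha).mono fun b s hb => ?_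
    rwa [add_right_comm] at hb

theorem Alg.Ensures.pure {a : α} {P : α → ℕ → Prop} (h : P a 0) :
    (pure a : Alg n α).Ensures f P := h

theorem ensures_tick (m : ℕ) : (tick m : Alg n Unit).Ensures f fun _ t => t = m := by
  induction m with
  | zero => rfl
  | succ m ih => exact ih.mono fun _ t h => by rw [h]

theorem Alg.Ensures.tick_bind {m : ℕ} {q : Unit → Alg n β} {P : β → ℕ → Prop}
    (h : (q ()).Ensures f fun b s => P b (m + s)) : (tick m >>= q).Ensures f P :=
  (ensures_tick m).bind fun _ _ ht => ht ▸ h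

theorem ensures_foldlM {Inv : β → Prop} {step : β → γ → Alg n β} {c : ℕ} (L : List γ)
    (h : ∀ G ∈ L, ∀ X, Inv X → (step X G).Ensures f fun X' t => Inv X' ∧ t ≤ c)
    (X : β) (hX : Inv X) :
    (L.foldlM step X).Ensures f fun X' t => Inv X' ∧ t ≤ L.length * c := by
  induction L generalizing X with
  | nil => exact ⟨hX, by simp⟩
  | cons G L ih =>
    rw [List.foldlM_cons]
    refine (h G List.mem_cons_self X hX).bind fun X₁ t₁ ⟨hI, ht⟩ =>
      (ih (fun G' hG' => h G' (List.mem_cons_of_mem _ hG')) X₁ hI).mono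
        fun X₂ t₂ ⟨hI', ht'⟩ => ⟨hI', ?_⟩
    rw [List.length_cons, Nat.succ_mul]
    omega

/-- A loop `foldlM` in which the pass for an entry `G` establishes `Q G`, and every pass preserves
what the earlier ones have established. -/
theorem ensures_foldlM_of_preserves {Q : γ → β → Prop} {step : β → γ → Alg n β} (L : List γ)
    (h : ∀ G ∈ L, ∀ X, (step X G).Ensures f fun X' _ => Q G X' ∧ ∀ G', Q G' X → Q G' X') (X : β) :
    (L.foldlM step X).Ensures f fun X' _ => (∀ G ∈ L, Q G X') ∧ ∀ G', Q G' X → Q G' X' := by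
  induction L generalizing X with
  | nil => exact Alg.Ensures.pure (by simp)
  | cons G L ih =>
    rw [List.foldlM_cons]
    refine (h G List.mem_cons_self X).bind fun X₁ _ ⟨hQ, hk⟩ =>
      (ih (fun G' hG' => h G' (List.mem_cons_of_mem _ hG')) X₁).mono
        fun X₂ _ ⟨hQ', hk'⟩ => ⟨fun G' hG' => ?_, fun G' hG' => hk' _ (hk _ hG')⟩
    rcases List.mem_cons.1 hG' with rfl | hG'
    · exact hk' _ hQ
    · exact hQ' _ hG'

end Ensures

/-! ### Values of sets with dummy elements -/

/-- The value `f(A)` of a set `A` that may contain dummy elements, which do not contribute. -/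
def ext {n : ℕ} (f : Finset (Fin n) → ℝ) (A : Finset (Elt n)) : ℝ :=
  f (Finset.univ.filter fun i => Sum.inl i ∈ A)

section Values

variable {n : ℕ} {f : Finset (Fin n) → ℝ}

theorem mem_realPart {X : List (Elt n)} {i : Fin n} : i ∈ realPart X ↔ Sum.inl i ∈ X := by
  simp only [realPart, List.mem_toFinset, List.mem_filterMap]
  constructor
  · rintro ⟨a, ha, h⟩
    cases a <;> simp_all
  · intro h
    exact ⟨_, h, rfl⟩

theorem apply_realPart (X : List (Elt n)) : f (realPart X) = ext f X.toFinset := by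
  unfold ext
  congr 1
  ext i
  simp [mem_realPart]

theorem card_realPart_le (X : List (Elt n)) : (realPart X).card ≤ X.length :=
  (List.toFinset_card_le _).trans (List.length_filterMap_le _ _)

theorem ensures_value (X : List (Elt n)) :
    (value X).Ensures f fun v t => v = ext f X.toFinset ∧ t ≤ 2 * X.length + 1 := by
  refine Alg.Ensures.tick_bind ⟨apply_realPart X, ?_⟩
  have := card_realPart_le X
  omega

theorem ensures_marginal (X : List (Elt n)) (e : Elt n) :
    (marginal X e).Ensures f fun v t =>
      v = ext f (insert e X.toFinset) - ext f X.toFinset ∧ t ≤ 4 * X.length + 5 := by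
  refine (ensures_value (e :: X)).bind fun a t₁ ⟨ha, h₁⟩ =>
    (ensures_value X).bind fun b t₂ ⟨hb, h₂⟩ => Alg.Ensures.tick_bind (Alg.Ensures.pure ⟨?_, ?_⟩)
  · rw [ha, hb, List.toFinset_cons]
  · simp only [List.length_cons] at h₁
    omega

theorem ensures_mem (e : Elt n) (l : List (Elt n)) :
    (mem e l).Ensures f fun b t => (b = true ↔ e ∈ l) ∧ t ≤ l.length + 1 := by
  induction l with
  | nil => exact Alg.Ensures.tick_bind (Alg.Ensures.pure (by simp))
  | cons y ys ih =>
    refine Alg.Ensures.tick_bind ?_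
    split_ifs with h
    · exact Alg.Ensures.pure (by simp [h])
    · refine ih.mono fun b t ⟨hb, ht⟩ => ⟨by simp [hb, h], ?_⟩
      simp only [List.length_cons]
      omega

theorem ensures_without (X E : List (Elt n)) :
    (without X E).Ensures f fun R t =>
      ((∀ e, e ∈ R ↔ e ∈ E ∧ e ∉ X) ∧ R.length ≤ E.length) ∧
        t ≤ E.length * (X.length + 2) + 1 := by
  induction E with
  | nil => exact Alg.Ensures.tick_bind (Alg.Ensures.pure (by simp))
  | cons e E ih =>
    refine (ensures_mem e X).bind fun b t₁ ⟨hb, h₁⟩ => ih.bind fun R t₂ ⟨⟨hR, hl⟩, h₂⟩ =>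
      Alg.Ensures.tick_bind (Alg.Ensures.pure ⟨⟨fun x => ?_, ?_⟩, ?_⟩)
    · split_ifs with h
      · rw [hR, List.mem_cons]
        refine ⟨fun h => ⟨Or.inr h.1, h.2⟩, ?_⟩
        rintro ⟨rfl | hx, hx'⟩
        · exact absurd (hb.1 h) hx'
        · exact ⟨hx, hx'⟩
      · rw [List.mem_cons, List.mem_cons, hR]
        have he : e ∉ X := fun he => h (hb.2 he)
        constructor
        · rintro (rfl | ⟨hx, hx'⟩)
          · exact ⟨Or.inl rfl, he⟩
          · exact ⟨Or.inr hx, hx'⟩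
        · rintro ⟨rfl | hx, hx'⟩
          · exact Or.inl rfl
          · exact Or.inr ⟨hx, hx'⟩
    · split_ifs <;> simp only [List.length_cons] <;> omega
    · rw [List.length_cons, Nat.succ_mul]
      omega

theorem ensures_union (I J : List (Elt n)) :
    (union I J).Ensures f fun R t =>
      ((∀ e, e ∈ R ↔ e ∈ I ∨ e ∈ J) ∧ R.length ≤ I.length + J.length) ∧
        t ≤ J.length * (I.length + 3) + 2 := by
  refine (ensures_without I J).bind fun R t ⟨⟨hR, hl⟩, ht⟩ =>
    Alg.Ensures.tick_bind (Alg.Ensures.pure ⟨⟨?_, ?_⟩, ?_⟩)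
  · intro e
    rw [List.mem_append, hR]
    tauto
  · rw [List.length_append]
    omega
  · linarith

section Argmax

variable {β : Type} {val : β → Alg n ℝ} {φ : β → ℝ} {c : ℕ}

theorem ensures_argmaxFrom {l : List β}
    (hval : ∀ y ∈ l, (val y).Ensures f fun v t => v = φ y ∧ t ≤ c) (best : β) :
    (argmaxFrom val best (φ best) l).Ensures f fun m t =>
      (m ∈ best :: l ∧ ∀ y ∈ best :: l, φ y ≤ φ m) ∧ t ≤ l.length * (c + 1) + 1 := by
  induction l generalizing best with
  | nil => exact Alg.Ensures.tick_bind (Alg.Ensures.pure (by simp))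
  | cons y ys ih =>
    have ih := ih fun z hz => hval z (List.mem_cons_of_mem _ hz)
    refine (hval y List.mem_cons_self).bind fun v t ⟨hv, ht⟩ => Alg.Ensures.tick_bind ?_
    subst hv
    split_ifs with h
    · refine (ih y).mono fun m s ⟨⟨hm, hmax⟩, hs⟩ => ⟨⟨List.mem_cons_of_mem _ hm, ?_⟩, ?_⟩
      · intro z hz
        rcases List.mem_cons.1 hz with rfl | hz
        · exact h.le.trans (hmax y List.mem_cons_self)
        · exact hmax z hz
      · rw [List.length_cons, Nat.succ_mul]
        omega
    · refine (ih best).mono fun m s ⟨⟨hm, hmax⟩, hs⟩ => ⟨⟨?_, ?_⟩, ?_⟩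
      · rcases List.mem_cons.1 hm with rfl | hm
        · exact List.mem_cons_self
        · exact List.mem_cons_of_mem _ (List.mem_cons_of_mem _ hm)
      · intro z hz
        rcases List.mem_cons.1 hz with rfl | hz
        · exact hmax _ List.mem_cons_self
        rcases List.mem_cons.1 hz with rfl | hz
        · exact (not_lt.1 h).trans (hmax _ List.mem_cons_self)
        · exact hmax z (List.mem_cons_of_mem _ hz)
      · rw [List.length_cons, Nat.succ_mul]
        omega

theorem ensures_argmax {l : List β}
    (hval : ∀ y ∈ l, (val y).Ensures f fun v t => v = φ y ∧ t ≤ c) :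
    (argmax val l).Ensures f fun r t =>
      ((r = none → l = []) ∧ ∀ m, r = some m → m ∈ l ∧ ∀ y ∈ l, φ y ≤ φ m) ∧
        t ≤ l.length * (c + 1) + 1 := by
  cases l with
  | nil => exact Alg.Ensures.tick_bind (Alg.Ensures.pure (by simp))
  | cons y ys =>
    refine (hval y List.mem_cons_self).bind fun v t ⟨hv, ht⟩ => ?_
    subst hv
    refine (ensures_argmaxFrom (fun z hz => hval z (List.mem_cons_of_mem _ hz)) y).bind fun m s ⟨hm, hs⟩ =>
      Alg.Ensures.tick_bind (Alg.Ensures.pure ⟨⟨by simp, ?_⟩, ?_⟩)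
    · rintro _ ⟨⟩
      exact hm
    · rw [List.length_cons, Nat.succ_mul]
      omega

end Argmax

/-- The subsets are listed as lists without unnecessary repetitions: every set occurs as a list
whose length is its cardinality, even if the given list has repeated entries. -/
theorem ensures_subsets (k : ℕ) (I : List (Elt n)) :
    (subsets k I).Ensures f fun L t =>
      ((∀ Y ∈ L, Y.length ≤ k) ∧
        (∀ A : Finset (Elt n), A ⊆ I.toFinset → A.card ≤ k →
          ∃ Y ∈ L, Y.toFinset = A ∧ Y.length = A.card) ∧
        L.length ≤ (I.length + 1) ^ k) ∧ t ≤ 3 * (I.length + 1) ^ (k + 1) := by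
  induction I generalizing k with
  | nil =>
    cases k with
    | zero =>
      refine Alg.Ensures.tick_bind (Alg.Ensures.pure ⟨⟨by simp, ?_, by simp⟩, by simp⟩)
      intro A hA _
      obtain rfl : A = ∅ := by simpa using hA
      exact ⟨[], by simp⟩
    | succ k =>
      refine Alg.Ensures.tick_bind (Alg.Ensures.pure ⟨⟨by simp, ?_, by simp⟩, by simp⟩)
      intro A hA _
      obtain rfl : A = ∅ := by simpa using hA
      exact ⟨[], by simp⟩
  | cons x xs ih =>
    cases k with
    | zero =>
      refine Alg.Ensures.tick_bind (Alg.Ensures.pure ⟨⟨by simp, ?_, by simp⟩, ?_⟩)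
      · intro A _ hA
        obtain rfl : A = ∅ := by simpa using hA
        exact ⟨[], by simp⟩
      · simp only [List.length_cons, zero_add, pow_one]
        omega
    | succ k =>
      refine (ih k).bind fun A t₁ ⟨⟨hA, hAc, hAl⟩, h₁⟩ => (ih (k + 1)).bind
        fun B t₂ ⟨⟨hB, hBc, hBl⟩, h₂⟩ =>
          Alg.Ensures.tick_bind (Alg.Ensures.pure ⟨⟨?_, ?_, ?_⟩, ?_⟩)
      · intro Y hY
        rcases List.mem_append.1 hY with hY | hY
        · obtain ⟨Z, hZ, rfl⟩ := List.mem_map.1 hY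
          simpa using hA Z hZ
        · exact hB Y hY
      · intro C hC hCk
        by_cases hx : x ∈ C
        · have hcard := Finset.card_erase_add_one hx
          obtain ⟨Y, hY, hYC, hYl⟩ := hAc (C.erase x)
            (fun y hy => by
              have := hC (Finset.mem_of_mem_erase hy)
              simpa [Finset.ne_of_mem_erase hy] using this) (by omega)
          refine ⟨x :: Y, by simp [hY], ?_, ?_⟩
          · rw [List.toFinset_cons, hYC, Finset.insert_erase hx]
          · rw [List.length_cons, hYl, hcard]
        · obtain ⟨Y, hY, h⟩ := hBc C
            (fun y hy => by
              have := hC hy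
              have hne : y ≠ x := fun h => hx (h ▸ hy)
              simpa [hne] using this) hCk
          exact ⟨Y, List.mem_append_right _ hY, h⟩
      · have h : (xs.length + 1) ^ k ≤ (xs.length + 2) ^ k := Nat.pow_le_pow_left (by omega) k
        simp only [List.length_append, List.length_map, List.length_cons]
        calc A.length + B.length ≤ (xs.length + 1) ^ k + (xs.length + 1) ^ (k + 1) := by omega
          _ = (xs.length + 1) ^ k * (xs.length + 2) := by ring
          _ ≤ (xs.length + 2) ^ k * (xs.length + 2) := Nat.mul_le_mul_right _ h
          _ = _ := by ring
      · have h : (xs.length + 1) ^ k ≤ (xs.length + 2) ^ k := Nat.pow_le_pow_left (by omega) k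
        have hpos : 1 ≤ (xs.length + 1) ^ k := Nat.one_le_pow _ _ (by omega)
        have hl : xs.length + 1 + 1 = xs.length + 2 := rfl
        simp only [List.length_cons, hl]
        have h' : (xs.length + 1) ^ (k + 1) ≤ (xs.length + 2) ^ (k + 1) :=
          Nat.pow_le_pow_left (by omega) _
        calc t₁ + (t₂ + (2 * A.length + 1 + 0))
            ≤ 3 * (xs.length + 1) ^ (k + 1) + 3 * (xs.length + 1) ^ (k + 1 + 1)
              + 3 * (xs.length + 1) ^ k := by omega
          _ = 3 * ((xs.length + 1) ^ k * (xs.length + 2)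
              + (xs.length + 1) ^ (k + 1) * (xs.length + 1)) := by ring
          _ ≤ 3 * ((xs.length + 2) ^ k * (xs.length + 2)
              + (xs.length + 2) ^ (k + 1) * (xs.length + 1)) := by gcongr
          _ = 3 * (xs.length + 2) ^ (k + 1 + 1) := by ring

theorem ensures_bruteForce (k : ℕ) (I : List (Elt n)) :
    (bruteForce k I).Ensures f fun X t =>
      (X.length ≤ k ∧
        ∀ A : Finset (Elt n), A ⊆ I.toFinset → A.card ≤ k → ext f A ≤ ext f X.toFinset) ∧
        t ≤ (2 * k + 6) * (I.length + 1) ^ (k + 1) := by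
  refine (ensures_subsets k I).bind fun L t₁ ⟨⟨hL, hLc, hLl⟩, h₁⟩ => ?_
  refine (ensures_argmax (φ := fun Y => ext f Y.toFinset) (c := 2 * k + 1) fun Y hY =>
    (ensures_value Y).mono fun v t ⟨hv, ht⟩ => ⟨hv, by have := hL Y hY; omega⟩).bind
      fun r t₂ ⟨⟨hr, hr'⟩, h₂⟩ => Alg.Ensures.pure ⟨?_, ?_⟩
  · cases r with
    | none =>
      obtain ⟨Y, hY, -⟩ := hLc ∅ (by simp) (by simp)
      simp [hr rfl] at hY
    | some X =>
      obtain ⟨hX, hmax⟩ := hr' X rfl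
      refine ⟨hL X hX, fun A hA hAk => ?_⟩
      obtain ⟨Y, hY, rfl, -⟩ := hLc A hA hAk
      exact hmax Y hY
  · have h3 : (I.length + 1) ^ k ≤ (I.length + 1) ^ (k + 1) :=
      Nat.pow_le_pow_right (by omega) (by omega)
    have h4 : 1 ≤ (I.length + 1) ^ (k + 1) := Nat.one_le_pow _ _ (by omega)
    have h5 : L.length * (2 * k + 1 + 1) ≤ (I.length + 1) ^ (k + 1) * (2 * k + 1 + 1) :=
      Nat.mul_le_mul_right _ (hLl.trans h3)
    linarith

end Values

/-! ### Submodular functions -/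

section Submodular

variable {n : ℕ} {f : Finset (Fin n) → ℝ}

theorem IsSubmodular.union_add_inter_le (hf : IsSubmodular f) (A B : Finset (Fin n)) :
    f (A ∪ B) + f (A ∩ B) ≤ f A + f B := by
  have key : ∀ Y : Finset (Fin n), Disjoint A Y →
      f (A ∪ Y) - f A ≤ f (A ∩ B ∪ Y) - f (A ∩ B) := by
    intro Y
    induction Y using Finset.induction_on with
    | empty => simp
    | insert i Y hi ih =>
      intro hd
      rw [Finset.disjoint_insert_right] at hd
      have h := hf (A ∩ B ∪ Y) (A ∪ Y)
        (Finset.union_subset_union_left Finset.inter_subset_left) i (by simp [hd.1, hi])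
      rw [Finset.union_insert, Finset.union_insert]
      linarith [ih hd.2]
  have h := key (B \ A) Finset.disjoint_sdiff
  have h1 : A ∩ B ∪ B \ A = B := by
    ext x
    simp only [Finset.mem_union, Finset.mem_inter, Finset.mem_sdiff]
    tauto
  rw [Finset.union_sdiff_self_eq_union, h1] at h
  linarith

theorem IsSubmodular.ext_union_add_ext_inter_le (hf : IsSubmodular f) (A B : Finset (Elt n)) :
    ext f (A ∪ B) + ext f (A ∩ B) ≤ ext f A + ext f B := by
  have h := hf.union_add_inter_le (Finset.univ.filter fun i => Sum.inl i ∈ A)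
    (Finset.univ.filter fun i => Sum.inl i ∈ B)
  rw [← Finset.filter_or, ← Finset.filter_and] at h
  simpa only [ext, Finset.mem_union, Finset.mem_inter] using h

/-- The marginal gains of disjoint sets add up to at least the marginal gain of their union. -/
theorem IsSubmodular.ext_biUnion_sub_le (hf : IsSubmodular f) {ι : Type} [DecidableEq ι]
    (A : Finset (Elt n)) (X : ι → Finset (Elt n)) (s : Finset ι)
    (hX : ∀ i ∈ s, ∀ j ∈ s, i ≠ j → Disjoint (X i) (X j)) :
    ext f (A ∪ s.biUnion X) - ext f A ≤ ∑ i ∈ s, (ext f (A ∪ X i) - ext f A) := by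
  induction s using Finset.induction_on with
  | empty => simp
  | insert i s hi ih =>
    have ih := ih fun a ha b hb => hX a (Finset.mem_insert_of_mem ha) b (Finset.mem_insert_of_mem hb)
    have h := hf.ext_union_add_ext_inter_le (A ∪ X i) (A ∪ s.biUnion X)
    have hd : Disjoint (X i) (s.biUnion X) := by
      rw [Finset.disjoint_biUnion_right]
      exact fun j hj => hX i (Finset.mem_insert_self _ _) j (Finset.mem_insert_of_mem hj)
        fun h => hi (h ▸ hj)
    rw [← Finset.union_inter_distrib_left, Finset.disjoint_iff_inter_eq_empty.1 hd,
      Finset.union_empty, ← Finset.union_union_distrib_left] at h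
    rw [Finset.biUnion_insert, Finset.sum_insert hi]
    linarith

/-- Adding one of many disjoint sets to `A` does little harm to a non-negative submodular function
on average. -/
theorem IsSubmodular.sub_one_mul_ext_le_sum (hf : IsSubmodular f) (h0 : ∀ X, 0 ≤ f X)
    (A : Finset (Elt n)) (X : ℕ → Finset (Elt n)) (T : ℕ)
    (hX : ∀ i < T, ∀ j < T, i ≠ j → Disjoint (X i) (X j)) :
    ((T : ℝ) - 1) * ext f A ≤ ∑ i ∈ Finset.range T, ext f (A ∪ X i) := by
  have h := hf.ext_biUnion_sub_le A X (Finset.range T) (by simpa using hX)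
  have h1 : 0 ≤ ext f (A ∪ (Finset.range T).biUnion X) := h0 _
  rw [Finset.sum_sub_distrib, Finset.sum_const, Finset.card_range, nsmul_eq_mul] at h
  linarith

/-- `X` lists `q` elements, each of which, when it was added to the current solution (with `G` as
the initial one), had at least the marginal gain of `o`. -/
def GreedyFor (f : Finset (Fin n) → ℝ) (G : Finset (Elt n)) (o : Elt n) (q : ℕ)
    (X : List (Elt n)) : Prop :=
  X.length = q ∧ ∀ i < q,
    ext f (insert o (G ∪ (X.take i).toFinset)) ≤ ext f (G ∪ (X.take (i + 1)).toFinset)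

/-- Among `T` disjoint greedy extensions of `G`, each of which competes with all elements of `D`,
one is nearly as good as the analysis of greedy for monotone functions promises. Indeed, the
extensions by the first `j` elements are disjoint too, and so adding them to `G ∪ D` costs only a
fraction `1 / T` of the value on average. Hence the gap between `1 - 1 / T` times this value
and the average value of the greedy solutions shrinks by a factor `1 - 1 / |D|` in each step. -/
theorem IsSubmodular.exists_ext_greedy_ge (hf : IsSubmodular f) (h0 : ∀ X, 0 ≤ f X)
    {G D : Finset (Elt n)} {q T : ℕ} {X : ℕ → List (Elt n)} (hD : D.Nonempty) (hDq : D.card ≤ q)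
    (hT : 1 ≤ T) (hX : ∀ i < T, ∀ j < T, i ≠ j → Disjoint (X i).toFinset (X j).toFinset)
    (hg : ∀ i < T, ∀ o ∈ D, GreedyFor f G o q (X i)) :
    ∃ i < T, (1 - Real.exp (-1)) * ((1 - 1 / (T : ℝ)) * ext f (G ∪ D)) ≤
      ext f (G ∪ (X i).toFinset) := by
  obtain ⟨o₀, ho₀⟩ := hD
  have hm : (1 : ℝ) ≤ D.card := by exact_mod_cast Finset.card_pos.2 ⟨o₀, ho₀⟩
  have hT' : (1 : ℝ) ≤ T := by exact_mod_cast hT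
  set Y : ℕ → ℕ → Finset (Elt n) := fun i j => ((X i).take j).toFinset with hY
  set a : ℕ → ℝ := fun j => ∑ i ∈ Finset.range T, ext f (G ∪ Y i j) with ha
  set b : ℝ := ((T : ℝ) - 1) * ext f (G ∪ D) with hb
  have hb0 : 0 ≤ b := mul_nonneg (by linarith) (h0 _)
  have hYX : ∀ i j, Y i j ⊆ (X i).toFinset := fun i j x hx => by
    simp only [hY, List.mem_toFinset] at hx ⊢
    exact List.mem_of_mem_take hx
  -- Here `a j` and `b` are `T` times the averages of the values of the greedy solutions after `j`
  -- steps, and of the lower bound for the values of their unions with `D`.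
  have hstep : ∀ j < q, b - a j ≤ D.card * (a (j + 1) - a j) := by
    intro j hj
    have h1 : ∀ i ∈ Finset.range T, ext f (G ∪ D ∪ Y i j) - ext f (G ∪ Y i j) ≤
        D.card * (ext f (G ∪ Y i (j + 1)) - ext f (G ∪ Y i j)) := by
      intro i hi
      have h2 := hf.ext_biUnion_sub_le (G ∪ Y i j) (fun o => {o}) D (by simp)
      rw [Finset.biUnion_singleton_eq_self, Finset.union_right_comm] at h2
      refine h2.trans ?_
      rw [← nsmul_eq_mul]
      refine Finset.sum_le_card_nsmul _ _ _ fun o ho => ?_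
      have h3 := (hg i (Finset.mem_range.1 hi) o ho).2 j hj
      rw [Finset.union_comm, ← Finset.insert_eq]
      exact sub_le_sub_right h3 _
    have h2 := Finset.sum_le_sum h1
    have h3 := hf.sub_one_mul_ext_le_sum h0 (G ∪ D) (fun i => Y i j) T fun i hi i' hi' hne =>
      Finset.disjoint_of_subset_left (hYX i j)
        (Finset.disjoint_of_subset_right (hYX i' j) (hX i hi i' hi' hne))
    rw [← Finset.mul_sum, Finset.sum_sub_distrib, Finset.sum_sub_distrib] at h2
    simp only [ha]
    linarith
  have hgap : ∀ j ≤ q, b - a j ≤ (1 - 1 / (D.card : ℝ)) ^ j * b := by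
    intro j
    induction j with
    | zero =>
      intro _
      have : 0 ≤ a 0 := Finset.sum_nonneg fun i _ => h0 _
      simpa using this
    | succ j ih =>
      intro hj
      have h1 := ih (by omega)
      have h2 := hstep j (by omega)
      have h3 : (0 : ℝ) ≤ 1 - 1 / D.card := by
        rw [sub_nonneg, div_le_one (by linarith)]
        exact hm
      have h4 : (b - a j) / D.card ≤ a (j + 1) - a j := by
        rw [div_le_iff₀' (by linarith)]
        exact h2
      calc b - a (j + 1) ≤ (1 - 1 / (D.card : ℝ)) * (b - a j) := by
            rw [sub_mul, one_mul, one_div_mul_eq_div]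
            linarith
        _ ≤ (1 - 1 / (D.card : ℝ)) * ((1 - 1 / (D.card : ℝ)) ^ j * b) :=
            mul_le_mul_of_nonneg_left h1 h3
        _ = _ := by ring
  have hexp : (1 - 1 / (D.card : ℝ)) ^ q ≤ Real.exp (-1) := by
    refine le_trans (pow_le_pow_of_le_one ?_ ?_ hDq) (Real.one_sub_div_pow_le_exp_neg hm)
    · rw [sub_nonneg, div_le_one (by linarith)]
      exact hm
    · rw [sub_le_self_iff]
      positivity
  have hq := (hgap q le_rfl).trans (mul_le_mul_of_nonneg_right hexp hb0)
  have hsum : ∑ _i ∈ Finset.range T, (1 - Real.exp (-1)) * ((1 - 1 / (T : ℝ)) * ext f (G ∪ D)) ≤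
      ∑ i ∈ Finset.range T, ext f (G ∪ Y i q) := by
    have h1 : (T : ℝ) * (1 - 1 / T) = T - 1 := by
      field_simp
    rw [Finset.sum_const, Finset.card_range, nsmul_eq_mul]
    calc (T : ℝ) * ((1 - Real.exp (-1)) * ((1 - 1 / (T : ℝ)) * ext f (G ∪ D)))
        = (1 - Real.exp (-1)) * (((T : ℝ) * (1 - 1 / T)) * ext f (G ∪ D)) := by ring
      _ = (1 - Real.exp (-1)) * b := by rw [h1]
      _ ≤ a q := by linarith
  obtain ⟨i, hi, h⟩ := Finset.exists_le_of_sum_le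
    (Finset.nonempty_range_iff.2 (by omega)) hsum
  refine ⟨i, Finset.mem_range.1 hi, h.trans_eq ?_⟩
  have hl := (hg i (Finset.mem_range.1 hi) o₀ ho₀).1
  simp only [hY]
  rw [List.take_of_length_le hl.le]

end Submodular

/-! ### Greedy and the recursion -/

section Recursion

variable {n : ℕ} {f : Finset (Fin n) → ℝ}

theorem ensures_greedy (E : List (Elt n)) (j : ℕ) (X : List (Elt n)) :
    (greedy E j X).Ensures f fun R t =>
      (R.length ≤ j ∧ (∀ e ∈ R, e ∈ E) ∧
        ∀ o ∈ E, o ∉ X → o ∉ R → GreedyFor f X.toFinset o j R) ∧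
        t ≤ j * (E.length * (5 * (X.length + j) + 8) + 3) + 1 := by
  induction j generalizing X with
  | zero => exact Alg.Ensures.tick_bind (Alg.Ensures.pure (by simp [GreedyFor]))
  | succ j ih =>
    refine (ensures_without X E).bind fun C t₁ ⟨⟨hC, hCl⟩, h₁⟩ =>
      (ensures_argmax fun y _ => ensures_marginal X y).bind fun r t₂ ⟨⟨hn, hs⟩, h₂⟩ =>
        Alg.Ensures.tick_bind ?_
    have h₂' : t₂ ≤ E.length * (4 * X.length + 5 + 1) + 1 :=
      h₂.trans (Nat.add_le_add_right (Nat.mul_le_mul_right _ hCl) _)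
    cases r with
    | none =>
      refine Alg.Ensures.pure ⟨⟨by simp, by simp, fun o ho hX _ => ?_⟩, ?_⟩
      · have := (hC o).2 ⟨ho, hX⟩
        simp [hn rfl] at this
      · nlinarith [Nat.zero_le (j * (E.length * (5 * (X.length + (j + 1)) + 8) + 3))]
    | some e =>
      obtain ⟨heC, hmax⟩ := hs e rfl
      refine (ih (e :: X)).bind fun R t₃ ⟨⟨hl, hE, hg⟩, h₃⟩ =>
        Alg.Ensures.pure ⟨⟨?_, ?_, ?_⟩, ?_⟩
      · simpa using hl
      · intro x hx
        rcases List.mem_cons.1 hx with rfl | hx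
        · exact ((hC _).1 heC).1
        · exact hE x hx
      · intro o ho hX hR
        rw [List.mem_cons, not_or] at hR
        obtain ⟨hlen, hstep⟩ := hg o ho (by simp [hR.1, hX]) hR.2
        refine ⟨by simp [hlen], fun i hi => ?_⟩
        cases i with
        | zero =>
          have := hmax o ((hC o).2 ⟨ho, hX⟩)
          simp only [List.take_zero, List.toFinset_nil, Finset.union_empty, zero_add,
            List.take_succ_cons, List.toFinset_cons, insert_empty_eq, Finset.union_singleton]
          linarith
        | succ i =>
          have := hstep i (by omega)
          simpa only [List.take_succ_cons, List.toFinset_cons, Finset.union_insert,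
            Finset.insert_union] using this
      · simp only [List.length_cons] at h₃
        nlinarith

/-- The sets `X i` found by the greedy runs are disjoint, and they compete with all elements that
none of them contains. -/
theorem ensures_greedyRuns {k M : ℕ} {G : List (Elt n)} (hG : G.length ≤ k) (m : ℕ)
    (E J : List (Elt n)) (hM : E.length ≤ M) :
    (greedyRuns k G m E J).Ensures f fun J' t =>
      ((∃ X : ℕ → List (Elt n), (∀ i < m, ∀ e ∈ X i, e ∈ E ∧ e ∈ J') ∧
          (∀ i < m, ∀ j < m, i ≠ j → Disjoint (X i).toFinset (X j).toFinset) ∧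
          ∀ i < m, ∀ o ∈ E, o ∉ G → o ∉ J' → GreedyFor f G.toFinset o (k - G.length) (X i)) ∧
        (∀ e ∈ J, e ∈ J') ∧ J'.length ≤ J.length + m * k) ∧
        t ≤ m * (M * (5 * k ^ 2 + 9 * k + 2) + 5 * k + 4) + 1 := by
  induction m generalizing E J with
  | zero => exact Alg.Ensures.tick_bind (Alg.Ensures.pure (by simp))
  | succ m ih =>
    refine Alg.Ensures.tick_bind ?_
    refine (ensures_greedy E (k - G.length) G).bind fun X t₁ ⟨⟨hXl, hXE, hg⟩, h₁⟩ =>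
      (ensures_without X E).bind fun E₁ t₂ ⟨⟨hE₁, hl⟩, h₂⟩ => Alg.Ensures.tick_bind ?_
    refine (ih E₁ (X ++ J) (hl.trans hM)).mono
      fun J' t₃ ⟨⟨⟨X', hX', hd, hg'⟩, hJ, hJl⟩, h₃⟩ => ⟨⟨?_, ?_, ?_⟩, ?_⟩
    · have hd0 : ∀ j < m, Disjoint X.toFinset (X' j).toFinset := by
        intro j hj
        rw [Finset.disjoint_left]
        intro x hx hx'
        rw [List.mem_toFinset] at hx hx'
        exact ((hE₁ x).1 (hX' j hj x hx').1).2 hx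
      refine ⟨fun i => Nat.casesOn i X X', ?_, ?_, ?_⟩
      · rintro (_ | i) hi e he
        · exact ⟨hXE e he, hJ e (List.mem_append_left _ he)⟩
        · obtain ⟨h, h'⟩ := hX' i (by omega) e he
          exact ⟨((hE₁ e).1 h).1, h'⟩
      · rintro (_ | i) hi (_ | j) hj hne
        · exact absurd rfl hne
        · exact hd0 j (by omega)
        · exact (hd0 i (by omega)).symm
        · exact hd i (by omega) j (by omega) (by omega)
      · rintro (_ | i) hi o hoE hoG hoJ
        · exact hg o hoE hoG fun h => hoJ (hJ o (List.mem_append_left _ h))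
        · exact hg' i (by omega) o
            ((hE₁ o).2 ⟨hoE, fun h => hoJ (hJ o (List.mem_append_left _ h))⟩) hoG hoJ
    · exact fun e he => hJ e (List.mem_append_right _ he)
    · rw [List.length_append] at hJl
      rw [Nat.succ_mul]
      omega
    · have hXk : X.length ≤ k := by omega
      have h1 : t₁ ≤ k * (M * (5 * k + 8) + 3) + 1 := by
        rw [Nat.add_sub_cancel' hG] at h₁
        refine h₁.trans ?_
        gcongr
        omega
      have h2 : t₂ ≤ M * (k + 2) + 1 := by
        refine h₂.trans ?_
        gcongr
      nlinarith

/-- A bound for the time that one level of the recursion takes to list the subsets of `I`, and also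
for the time that it takes for one of these subsets, apart from the recursive call. Here `B` and `M`
bound the lengths of `I` and of the ground list. -/
def levelCost (k T B M : ℕ) : ℕ :=
  (2 * k + 6) * (B + 1) ^ (k + 1) + (T * (M * (5 * k ^ 2 + 9 * k + 2) + 5 * k + 4) + 1)
    + (T * k * (B + 3) + 2) + (4 * k + 5)

/-- With `W = levelCost k T B M`, and at most `N = (B + 1) ^ k` subsets on each level, the times `t r`
satisfy `t (r + 1) ≤ W + N * (W + t r)`. As `I` grows by at most `T * k` elements per level, it never
has more than `B`. -/
theorem ensures_recursive_cost {E : List (Elt n)} {k T M B : ℕ} (hM : E.length ≤ M) (r : ℕ)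
    (I : List (Elt n)) (hI : I.length + r * (T * k) ≤ B) :
    (recursive E k T r I).Ensures f fun Y t =>
      Y.length ≤ k ∧ t ≤ levelCost k T B M * (4 * (B + 1) ^ k) ^ (r + 1) := by
  have hN : 1 ≤ (B + 1) ^ k := Nat.one_le_pow _ _ (by omega)
  have hloop : ∀ (I : List (Elt n)) (L : ℕ) (t₁ : ℕ), I.length ≤ B → L ≤ (I.length + 1) ^ k →
      t₁ ≤ 3 * (I.length + 1) ^ (k + 1) →
      L ≤ (B + 1) ^ k ∧ t₁ ≤ levelCost k T B M := by
    intro I L t₁ hI hL ht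
    have h1 : (I.length + 1) ^ (k + 1) ≤ (B + 1) ^ (k + 1) := Nat.pow_le_pow_left (by omega) _
    refine ⟨hL.trans (Nat.pow_le_pow_left (by omega) _), ?_⟩
    unfold levelCost
    have h2 : 3 * (B + 1) ^ (k + 1) ≤ (2 * k + 6) * (B + 1) ^ (k + 1) :=
      Nat.mul_le_mul_right _ (by omega)
    omega
  induction r generalizing I with
  | zero =>
    refine (ensures_subsets k I).bind fun L t₁ ⟨⟨hL, _, hLl⟩, h₁⟩ => ?_
    obtain ⟨hL', h₁'⟩ := hloop I L.length t₁ (by omega) hLl h₁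
    refine (ensures_foldlM (Inv := fun X => X.length ≤ k)
      (c := levelCost k T B M) L (fun G hG X hX => Alg.Ensures.tick_bind ?_) [] (by simp)).mono
        fun Y t ⟨hY, ht⟩ => ⟨hY, ?_⟩
    · refine (ensures_greedyRuns (hL G hG) T E [] hM).bind fun J t₂ ⟨_, h₂⟩ =>
        (ensures_bruteForce k I).mono fun Y t₃ ⟨⟨hY, _⟩, h₃⟩ => ⟨hY, ?_⟩
      have h4 : (2 * k + 6) * (I.length + 1) ^ (k + 1) ≤ (2 * k + 6) * (B + 1) ^ (k + 1) := by
        gcongr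
        omega
      unfold levelCost
      omega
    · have h5 := Nat.mul_le_mul_right (levelCost k T B M) hL'
      rw [zero_add, pow_one]
      nlinarith [Nat.mul_le_mul_left (levelCost k T B M) hN]
  | succ r ih =>
    refine (ensures_subsets k I).bind fun L t₁ ⟨⟨hL, _, hLl⟩, h₁⟩ => ?_
    obtain ⟨hL', h₁'⟩ := hloop I L.length t₁ (by omega) hLl h₁
    set N := (B + 1) ^ k
    set W := levelCost k T B M with hW
    refine (ensures_foldlM (Inv := fun X => X.length ≤ k)
      (c := W + W * (4 * N) ^ (r + 1)) L
      (fun G hG X hX => Alg.Ensures.tick_bind ?_) [] (by simp)).mono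
        fun Y t ⟨hY, ht⟩ => ⟨hY, ?_⟩
    · refine (ensures_greedyRuns (hL G hG) T E [] hM).bind fun J t₂ ⟨⟨_, _, hJ⟩, h₂⟩ =>
        (ensures_union I J).bind fun K t₃ ⟨⟨_, hK⟩, h₃⟩ => ?_
      rw [List.length_nil, zero_add] at hJ
      rw [Nat.succ_mul] at hI
      refine (ih K (by omega)).bind fun Y t₄ ⟨hY, h₄⟩ =>
        (ensures_value Y).bind fun a t₅ ⟨_, h₅⟩ => (ensures_value X).bind fun b t₆ ⟨_, h₆⟩ =>
          Alg.Ensures.tick_bind (Alg.Ensures.pure ⟨?_, ?_⟩)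
      · split_ifs <;> assumption
      · have h7 : J.length * (I.length + 3) ≤ T * k * (B + 3) := by
          gcongr
          omega
        have h8 : 1 + t₂ + t₃ + t₅ + t₆ + 1 ≤ W := by
          rw [hW]
          unfold levelCost
          omega
        omega
    · have h5 := Nat.mul_le_mul_right (W + W * (4 * N) ^ (r + 1)) hL'
      have h6 : 1 ≤ (4 * N) ^ (r + 1) := Nat.one_le_pow _ _ (by omega)
      have h7 : W ≤ W * N := Nat.le_mul_of_pos_right _ hN
      have h8 : W * N * 1 ≤ W * N * (4 * N) ^ (r + 1) := Nat.mul_le_mul_left _ h6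
      calc t₁ + t ≤ W + N * (W + W * (4 * N) ^ (r + 1)) := by omega
        _ ≤ W * N * (4 * N) ^ (r + 1) * 4 := by nlinarith
        _ = W * (4 * N) ^ (r + 1 + 1) := by ring

/-- The first part holds because `I` only grows; so a good set that lies in the collection on some level
is never lost. For the second part, consider the branch of the recursion in which `G` is always `O ∩ I`. Either the value of `O ∩ I`
increases by `δ` on each level, or the greedy runs of some level take little of the value of
`O`, and one of them competes with the rest of `O`. -/
theorem ensures_recursive_value (hf : IsSubmodular f) (h0 : ∀ X, 0 ≤ f X) {E : List (Elt n)}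
    {k T : ℕ} (hT : 1 ≤ T) {O : Finset (Elt n)} (hO : O.card ≤ k) (hOE : ∀ o ∈ O, o ∈ E) {δ : ℝ}
    (hδ : δ ≤ ext f O) (r : ℕ) (I : List (Elt n)) :
    (recursive E k T r I).Ensures f fun Y _ =>
      (∀ A : Finset (Elt n), A ⊆ I.toFinset → A.card ≤ k → ext f A ≤ ext f Y.toFinset) ∧
        ((1 - Real.exp (-1)) * ((1 - 1 / (T : ℝ)) * (ext f O - δ)) ≤ ext f Y.toFinset ∨
          ext f (O ∩ I.toFinset) + r * δ ≤ ext f Y.toFinset) := by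
  have hOI : ∀ I : List (Elt n), (O ∩ I.toFinset).card ≤ k := fun I =>
    (Finset.card_le_card Finset.inter_subset_left).trans hO
  induction r generalizing I with
  | zero =>
    refine (ensures_subsets k I).bind fun L t₁ ⟨⟨hL, hLc, _⟩, _⟩ => ?_
    obtain ⟨G₀, hG₀, -⟩ := hLc ∅ (by simp) (by simp)
    refine (ensures_foldlM_of_preserves (Q := fun _ X => ∀ A : Finset (Elt n), A ⊆ I.toFinset → A.card ≤ k →
      ext f A ≤ ext f X.toFinset) L (fun G hG X => Alg.Ensures.tick_bind ?_) []).mono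
        fun Y t ⟨hY, _⟩ => ⟨hY G₀ hG₀, Or.inr ?_⟩
    · exact (ensures_greedyRuns (hL G hG) T E [] le_rfl).bind fun J t₂ _ =>
        (ensures_bruteForce k I).mono fun Y t₃ ⟨⟨_, hY⟩, _⟩ => ⟨hY, fun _ _ => hY⟩
    · simpa using hY G₀ hG₀ (O ∩ I.toFinset) Finset.inter_subset_right (hOI I)
  | succ r ih =>
    set θ := (1 - Real.exp (-1)) * ((1 - 1 / (T : ℝ)) * (ext f O - δ)) with hθ
    have hT' : (1 : ℝ) ≤ T := by exact_mod_cast hT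
    have hT1 : 0 ≤ 1 - 1 / (T : ℝ) := by
      rw [sub_nonneg, div_le_one (by linarith)]
      exact hT'
    have hT2 : 1 - 1 / (T : ℝ) ≤ 1 := sub_le_self _ (by positivity)
    have he0 : 0 ≤ 1 - Real.exp (-1) := sub_nonneg.2 (Real.exp_le_one_iff.2 (by norm_num))
    have he1 : 1 - Real.exp (-1) ≤ 1 := sub_le_self _ (Real.exp_pos _).le
    refine (ensures_subsets k I).bind fun L t₁ ⟨⟨hL, hLc, _⟩, _⟩ => ?_
    obtain ⟨G₀, hG₀, hG₀O, hG₀l⟩ := hLc (O ∩ I.toFinset) Finset.inter_subset_right (hOI I)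
    refine (ensures_foldlM_of_preserves (Q := fun G X => (∀ A : Finset (Elt n), A ⊆ I.toFinset → A.card ≤ k →
      ext f A ≤ ext f X.toFinset) ∧ (G.toFinset = O ∩ I.toFinset → G.length = G.toFinset.card →
        θ ≤ ext f X.toFinset ∨ ext f (O ∩ I.toFinset) + (r + 1 : ℕ) * δ ≤ ext f X.toFinset))
      L (fun G hG X => Alg.Ensures.tick_bind ?_) []).mono
        fun Y t ⟨hY, _⟩ => ⟨(hY G₀ hG₀).1, (hY G₀ hG₀).2 hG₀O (hG₀O ▸ hG₀l)⟩
    refine (ensures_greedyRuns (hL G hG) T E [] le_rfl).bind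
      fun J t₂ ⟨⟨⟨X', hX', hd, hg⟩, _, _⟩, _⟩ =>
        (ensures_union I J).bind fun K t₃ ⟨⟨hK, _⟩, _⟩ => (ih K).bind fun Y t₄ ⟨hYA, hYO⟩ =>
        (ensures_value Y).bind fun a t₅ ⟨ha, _⟩ => (ensures_value X).bind fun b t₆ ⟨hb, _⟩ =>
          Alg.Ensures.tick_bind (Alg.Ensures.pure ?_)
    have hIK : I.toFinset ⊆ K.toFinset := fun x hx => by
      rw [List.mem_toFinset] at hx ⊢
      exact (hK x).2 (Or.inl hx)
    set Z := if b < a then Y else X with hZ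
    have hYZ : ext f Y.toFinset ≤ ext f Z.toFinset := by
      rw [hZ]
      split_ifs with h
      · exact le_rfl
      · rw [← ha, ← hb]
        exact not_lt.1 h
    have hXZ : ext f X.toFinset ≤ ext f Z.toFinset := by
      rw [hZ]
      split_ifs with h
      · rw [← ha, ← hb]
        exact h.le
      · exact le_rfl
    refine ⟨⟨fun A hA hAk => (hYA A (hA.trans hIK) hAk).trans hYZ, fun hGO hGl => ?_⟩,
      fun G' hG' => ⟨fun A hA hAk => (hG'.1 A hA hAk).trans hXZ, fun h h' =>
        (hG'.2 h h').imp (fun h => h.trans hXZ) fun h => h.trans hXZ⟩⟩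
    rcases hYO with hYO | hYO
    · exact Or.inl (hYO.trans hYZ)
    by_cases hinc : ext f (O ∩ I.toFinset) + δ ≤ ext f (O ∩ K.toFinset)
    · right
      push_cast
      linarith
    left
    -- The elements of `O` that are new in `K` add less than `δ` to `G = O ∩ I`, and hence, by
    -- submodularity, also to the larger set `G ∪ D`.
    set D := O \ K.toFinset with hD
    have hGD : ext f O - δ ≤ ext f (G.toFinset ∪ D) := by
      have h := hf.ext_union_add_ext_inter_le (O ∩ K.toFinset) (G.toFinset ∪ D)
      have h1 : O ∩ K.toFinset ∪ (G.toFinset ∪ D) = O := by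
        ext x
        simp only [hGO, hD, Finset.mem_union, Finset.mem_inter, Finset.mem_sdiff]
        tauto
      have h2 : O ∩ K.toFinset ∩ (G.toFinset ∪ D) = O ∩ I.toFinset := by
        ext x
        have := @hIK x
        simp only [hGO, hD, Finset.mem_union, Finset.mem_inter, Finset.mem_sdiff]
        tauto
      rw [h1, h2] at h
      linarith
    rcases D.eq_empty_or_nonempty with hD0 | hD0
    · refine le_trans ?_ (((hGD.trans_eq (by rw [hD0, Finset.union_empty])).trans
        (hYA _ (hGO ▸ Finset.inter_subset_right.trans hIK) (hGO ▸ hOI I))).trans hYZ)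
      have h1 : 0 ≤ ext f O - δ := sub_nonneg.2 hδ
      have h2 : (1 - 1 / (T : ℝ)) * (ext f O - δ) ≤ ext f O - δ := mul_le_of_le_one_left h1 hT2
      exact (mul_le_of_le_one_left (mul_nonneg hT1 h1) he1).trans h2
    · have hcard : D.card ≤ k - G.length := by
        have h1 : D.card + G.toFinset.card = (D ∪ G.toFinset).card := by
          rw [Finset.card_union_of_disjoint]
          rw [Finset.disjoint_left]
          intro x hx hx'
          rw [hGO] at hx'
          exact (Finset.mem_sdiff.1 hx).2 (hIK (Finset.mem_inter.1 hx').2)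
        have h2 : (D ∪ G.toFinset).card ≤ O.card := by
          refine Finset.card_le_card (Finset.union_subset Finset.sdiff_subset ?_)
          rw [hGO]
          exact Finset.inter_subset_left
        omega
      have hgD : ∀ i < T, ∀ o ∈ D, GreedyFor f G.toFinset o (k - G.length) (X' i) := by
        intro i hi o ho
        rw [hD, Finset.mem_sdiff, List.mem_toFinset, hK, not_or] at ho
        refine hg i hi o (hOE o ho.1) (fun h => ho.2.1 ?_) ho.2.2
        have : o ∈ O ∩ I.toFinset := hGO ▸ List.mem_toFinset.2 h
        exact List.mem_toFinset.1 (Finset.mem_inter.1 this).2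
      obtain ⟨i, hi, h⟩ := hf.exists_ext_greedy_ge h0 hD0 hcard hT hd hgD
      refine le_trans ?_ ((h.trans (hYA _ ?_ ?_)).trans hYZ)
      · exact mul_le_mul_of_nonneg_left (mul_le_mul_of_nonneg_left hGD hT1) he0
      · refine Finset.union_subset ?_ fun x hx => ?_
        · rw [hGO]
          exact Finset.inter_subset_right.trans hIK
        · rw [List.mem_toFinset] at hx ⊢
          exact (hK x).2 (Or.inr (hX' i hi x hx).2)
      · obtain ⟨o, ho⟩ := hD0
        have h1 := (hgD i hi o ho).1
        have h2 := List.toFinset_card_le (X' i)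
        have h3 := Finset.card_union_le G.toFinset (X' i).toFinset
        have h4 := hL G hG
        omega

end Recursion

/-! ### The cost of the stream -/

section Stream

variable {n : ℕ} {f : Finset (Fin n) → ℝ}

theorem ensures_shuffleFrom (i : ℕ) (a : Array (Elt n)) :
    (shuffleFrom i a).Ensures f fun b t => b.size = a.size ∧ t ≤ 2 * i := by
  induction i generalizing a with
  | zero => exact Alg.Ensures.pure (by simp)
  | succ i ih =>
    refine fun j => (ih (a.swapIfInBounds i j)).mono fun b t ⟨hb, ht⟩ => ⟨?_, ?_⟩
    · rw [hb, Array.size_swapIfInBounds]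
    · omega

theorem ensures_shuffle (E : List (Elt n)) :
    (shuffle E).Ensures f fun R t => R.length = E.length ∧ t ≤ 4 * E.length := by
  refine Alg.Ensures.tick_bind ((ensures_shuffleFrom E.length E.toArray).bind fun a t ⟨ha, ht⟩ =>
    Alg.Ensures.tick_bind (Alg.Ensures.pure ⟨?_, ?_⟩))
  · simpa using ha
  · omega

theorem ensures_selectWindows {w s : ℕ} (i : ℕ) (stream S : List (Elt n)) (hs : S.length + i ≤ s) :
    (selectWindows w i stream S).Ensures f fun r t =>
      (r.1.length ≤ s ∧ (∀ p ∈ r.2.1, p.1.length ≤ s) ∧ r.2.1.length ≤ i ∧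
        r.2.2.length ≤ stream.length) ∧ t ≤ i * (w * (4 * s + 7) + 2) + 1 := by
  induction i generalizing stream S with
  | zero => exact Alg.Ensures.tick_bind (Alg.Ensures.pure (by simpa using hs))
  | succ i ih =>
    refine Alg.Ensures.tick_bind
      ((ensures_argmax fun y _ => ensures_marginal S y).bind fun r t ⟨_, ht⟩ => ?_)
    have h1 : t ≤ w * (4 * s + 6) + 1 := by
      have h2 : 4 * S.length + 5 + 1 ≤ 4 * s + 6 := by omega
      exact ht.trans (Nat.add_le_add_right (Nat.mul_le_mul (List.length_take_le _ _) h2) _)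
    have hd : (stream.drop w).length ≤ stream.length := by
      rw [List.length_drop]
      omega
    cases r with
    | none =>
      refine (ih (stream.drop w) S (by omega)).mono
        fun r t' ⟨⟨h₁, h₂, h₃, h₄⟩, ht'⟩ => ⟨⟨h₁, h₂, by omega, h₄.trans hd⟩, ?_⟩
      rw [Nat.succ_mul]
      linarith
    | some e =>
      refine (ih (stream.drop w) (e :: S) (by simp only [List.length_cons]; omega)).bind
        fun r t' ⟨⟨h₁, h₂, h₃, h₄⟩, ht'⟩ =>
          Alg.Ensures.pure ⟨⟨h₁, ?_, by simpa using h₃, h₄.trans hd⟩, ?_⟩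
      · intro p hp
        rcases List.mem_cons.1 hp with rfl | hp
        · dsimp only
          omega
        · exact h₂ p hp
      · rw [Nat.succ_mul]
        linarith

theorem ensures_scanElement {thr : ℝ} {h s : ℕ} (hthr : thr ≤ h) (e : Elt n)
    (P : List (List (Elt n) × Elt n)) (hP : ∀ p ∈ P, p.1.length ≤ s) (H : List (Elt n))
    (hH : H.length ≤ h) :
    (scanElement thr e P H).Ensures f fun J t =>
      J.length ≤ h ∧ t ≤ P.length * (8 * s + 2 * h + 17) + 1 := by
  induction P generalizing H with
  | nil => exact Alg.Ensures.tick_bind (Alg.Ensures.pure (by simpa using hH))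
  | cons p P ih =>
    obtain ⟨S, a⟩ := p
    have hS : S.length ≤ s := hP _ List.mem_cons_self
    have ih := ih fun q hq => hP q (List.mem_cons_of_mem _ hq)
    refine (ensures_marginal S e).bind fun x t₁ ⟨_, h₁⟩ =>
      (ensures_marginal S a).bind fun y t₂ ⟨_, h₂⟩ => Alg.Ensures.tick_bind ?_
    rw [List.length_cons, Nat.succ_mul]
    split_ifs with hlt
    · have hlt' : H.length < h := by exact_mod_cast hlt.2.trans_le hthr
      refine (ensures_union H [e]).bind fun J t₃ ⟨⟨_, hJ⟩, h₃⟩ => ?_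
      rw [List.length_singleton] at hJ h₃
      refine (ih J (by omega)).mono fun J' t₄ ⟨hJ', h₄⟩ => ⟨hJ', ?_⟩
      omega
    · refine (ih H hH).mono fun J t₃ ⟨hJ, h₃⟩ => ⟨hJ, ?_⟩
      omega

theorem ensures_scanStream {thr : ℝ} {h s : ℕ} (hthr : thr ≤ h)
    {P : List (List (Elt n) × Elt n)} (hP : ∀ p ∈ P, p.1.length ≤ s) (stream H : List (Elt n))
    (hH : H.length ≤ h) :
    (scanStream thr P stream H).Ensures f fun J t =>
      J.length ≤ h ∧ t ≤ stream.length * (P.length * (8 * s + 2 * h + 17) + 2) + 1 := by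
  induction stream generalizing H with
  | nil => exact Alg.Ensures.tick_bind (Alg.Ensures.pure (by simpa using hH))
  | cons e stream ih =>
    refine Alg.Ensures.tick_bind ((ensures_scanElement hthr e P hP H hH).bind
      fun J t ⟨hJ, ht⟩ => (ih J hJ).mono fun J' t' ⟨hJ', ht'⟩ => ⟨hJ', ?_⟩)
    rw [List.length_cons, Nat.succ_mul]
    omega

/-- The threshold of the stream keeps `H` short; nothing else about its result is needed. -/
theorem ensures_symmetricStream (E : List (Elt n)) (k : ℕ) {ε : ℝ} (hε : ε ≤ 1) {h : ℕ}
    (hh : 18 * (k : ℝ) ^ 2 * Real.log k / ε ≤ h) :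
    (symmetricStream E k ε).Ensures f fun r t =>
      (r.1.length ≤ 3 * k ∧ r.2.1.length ≤ h) ∧
        t ≤ 5 * E.length + (3 * k * (E.length * (12 * k + 7) + 2) + 1)
          + (E.length * (3 * k * (24 * k + 2 * h + 17) + 2) + 1) + (h * (3 * k + 3) + 2)
          + (2 * k + 6) * (3 * k + h + 1) ^ (k + 1) := by
  refine (ensures_shuffle E).bind fun stream t₁ ⟨hl, h₁⟩ => Alg.Ensures.tick_bind ?_
  refine (ensures_selectWindows (s := 3 * k) (3 * k) stream [] (by simp)).bind
    fun r t₂ ⟨⟨hr, hrP, hrl, hrs⟩, h₂⟩ =>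
      (ensures_scanStream hh hrP r.2.2 [] (Nat.zero_le _)).bind fun H t₃ ⟨hH, h₃⟩ =>
        (ensures_union r.1 H).bind fun I t₄ ⟨⟨_, hI⟩, h₄⟩ =>
          (ensures_bruteForce k I).bind fun X t₅ ⟨_, h₅⟩ => Alg.Ensures.pure ⟨⟨hr, hH⟩, ?_⟩
  have hw : ⌊ε * E.length⌋₊ / (3 * k) ≤ E.length := by
    refine (Nat.div_le_self _ _).trans (Nat.floor_le_of_le ?_)
    exact mul_le_of_le_one_left (Nat.cast_nonneg _) hε
  have h2 : t₂ ≤ 3 * k * (E.length * (12 * k + 7) + 2) + 1 := by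
    rw [show 4 * (3 * k) = 12 * k by ring] at h₂
    refine h₂.trans ?_
    gcongr
  have h3 : t₃ ≤ E.length * (3 * k * (24 * k + 2 * h + 17) + 2) + 1 := by
    rw [show 8 * (3 * k) = 24 * k by ring] at h₃
    refine h₃.trans ?_
    gcongr
    omega
  have h4 : t₄ ≤ h * (3 * k + 3) + 2 := by
    refine h₄.trans ?_
    gcongr
  have h5 : t₅ ≤ (2 * k + 6) * (3 * k + h + 1) ^ (k + 1) := by
    refine h₅.trans ?_
    gcongr
    omega
  omega

end Stream

/-! ### Total cost and value of `FPT⁺` -/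

section Total

variable {n : ℕ} {f : Finset (Fin n) → ℝ}

theorem levelCost_le {k T B M K : ℕ} (hn : 1 ≤ n) (hk : 20 * k + 20 ≤ K) (hT : T ≤ K)
    (hB : B + 1 ≤ K) (hM : M ≤ K * n) : levelCost k T B M ≤ 10 * (K ^ (k + 4) * n) := by
  have hK : 1 ≤ K := by omega
  have hQ : ∀ j ≤ k + 4, K ^ j ≤ K ^ (k + 4) * n := fun j hj =>
    (Nat.pow_le_pow_right hK hj).trans (Nat.le_mul_of_pos_right _ hn)
  have h1 : (2 * k + 6) * (B + 1) ^ (k + 1) ≤ K ^ (k + 4) * n := by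
    refine le_trans ?_ (hQ (k + 2) (by omega))
    rw [pow_succ' K (k + 1)]
    gcongr
    omega
  have h2 : T * (M * (5 * k ^ 2 + 9 * k + 2) + 5 * k + 4) + 1 ≤ 3 * (K ^ (k + 4) * n) := by
    have h3 : 5 * k ^ 2 + 9 * k + 2 ≤ K * K := by nlinarith
    calc T * (M * (5 * k ^ 2 + 9 * k + 2) + 5 * k + 4) + 1
        = T * (M * (5 * k ^ 2 + 9 * k + 2) + (5 * k + 4)) + 1 := by ring
      _ ≤ K * (K * n * (K * K) + K) + 1 := by
          gcongr
          omega
      _ = K ^ 4 * n + K ^ 2 + K ^ 0 := by ring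
      _ ≤ 3 * (K ^ (k + 4) * n) := by
          have h4 : K ^ 4 * n ≤ K ^ (k + 4) * n :=
            Nat.mul_le_mul_right _ (Nat.pow_le_pow_right hK (by omega))
          have h5 := hQ 2 (by omega)
          have h6 := hQ 0 (by omega)
          omega
  have h3 : T * k * (B + 3) + 2 ≤ 4 * (K ^ (k + 4) * n) := by
    calc T * k * (B + 3) + 2 ≤ K * K * (K + 2) + 2 :=
          Nat.add_le_add_right (Nat.mul_le_mul (Nat.mul_le_mul hT (by omega)) (by omega)) 2
      _ = K ^ 3 + 2 * K ^ 2 + 2 := by ring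
      _ ≤ K ^ 3 + 3 * K ^ 2 := by nlinarith
      _ ≤ _ := by
          have h5 := hQ 2 (by omega)
          have h6 := hQ 3 (by omega)
          omega
  have h4 : 4 * k + 5 ≤ K ^ (k + 4) * n := by
    have h5 := hQ 1 (by omega)
    rw [pow_one] at h5
    omega
  unfold levelCost
  omega

/-- All costs are polynomials in a number `K` that exceeds the parameters and the lengths of the
lists, except for the `K ^ k` subsets on each of the `T + 1` levels of the recursion. -/
theorem ensures_fptPlus_cost {k T K h : ℕ} {ε : ℝ} (hε : ε ≤ 1) (hn : 1 ≤ n)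
    (hk : 20 * k + 20 ≤ K) (hT : T ≤ K) (hh : 18 * (k : ℝ) ^ 2 * Real.log k / ε ≤ h)
    (hhK : 24 * k + 2 * h + 17 ≤ K) (hB : 3 * k + h + T * (T * k) + 1 ≤ K)
    (hM : (groundList n k ε T).length ≤ K * n) :
    (fptPlus n k ε T).Ensures f fun X t =>
      X.card ≤ k ∧ t ≤ K ^ (k + 6 + (k + 1) * (T + 1)) * n := by
  set E := groundList n k ε T with hE
  refine Alg.Ensures.tick_bind ((ensures_symmetricStream E k hε hh).bind
    fun r t₁ ⟨⟨hS, hH⟩, h₁⟩ => (ensures_union r.1 r.2.1).bind fun I t₂ ⟨⟨_, hI⟩, h₂⟩ =>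
      (ensures_recursive_cost (B := 3 * k + h + T * (T * k)) le_rfl T I (by omega)).bind
        fun X t₃ ⟨hX, h₃⟩ => Alg.Ensures.tick_bind (Alg.Ensures.pure
          ⟨(card_realPart_le X).trans hX, ?_⟩))
  have hK : 1 ≤ K := by omega
  set Q := K ^ (k + 4) * n with hQ_def
  have hQ : ∀ j ≤ k + 4, K ^ j ≤ Q := fun j hj =>
    (Nat.pow_le_pow_right hK hj).trans (Nat.le_mul_of_pos_right _ hn)
  have hQn : ∀ j ≤ k + 4, K ^ j * n ≤ Q := fun j hj =>
    Nat.mul_le_mul_right _ (Nat.pow_le_pow_right hK hj)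
  have hM' : E.length ≤ Q := hM.trans (by simpa using hQn 1 (by omega))
  have hK1 : K ≤ Q := by simpa using hQ 1 (by omega)
  have hK2 := hQ 2 (by omega)
  have hK3 := hQn 3 (by omega)
  have a1 : 3 * k * (E.length * (12 * k + 7) + 2) + 1 ≤ 3 * Q := by
    calc 3 * k * (E.length * (12 * k + 7) + 2) + 1 ≤ K * (K * n * K + K) + K := by
          gcongr <;> omega
      _ = K ^ 3 * n + K ^ 2 + K := by ring
      _ ≤ 3 * Q := by omega
  have a2 : E.length * (3 * k * (24 * k + 2 * h + 17) + 2) + 1 ≤ 3 * Q := by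
    have h4 := hQn 2 (by omega)
    calc E.length * (3 * k * (24 * k + 2 * h + 17) + 2) + 1 ≤ K * n * (K * K + K) + K := by
          gcongr <;> omega
      _ = K ^ 3 * n + K ^ 2 * n + K := by ring
      _ ≤ 3 * Q := by omega
  have a3 : h * (3 * k + 3) + 2 ≤ 2 * Q := by
    calc h * (3 * k + 3) + 2 ≤ K * K + K := by
          gcongr <;> omega
      _ = K ^ 2 + K := by ring
      _ ≤ 2 * Q := by omega
  have a4 : (2 * k + 6) * (3 * k + h + 1) ^ (k + 1) ≤ Q := by
    refine le_trans ?_ (hQ (k + 2) (by omega))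
    rw [pow_succ' K (k + 1)]
    gcongr <;> omega
  have a5 : t₂ ≤ 2 * Q := by
    refine h₂.trans (le_trans ?_ a3)
    gcongr
  set R := K ^ ((k + 1) * (T + 1)) with hR
  have hR1 : 1 ≤ R := Nat.one_le_pow _ _ hK
  have a6 : t₃ ≤ 10 * Q * R := by
    refine h₃.trans (Nat.mul_le_mul (levelCost_le hn hk hT hB hM) ?_)
    rw [hR, pow_mul]
    refine Nat.pow_le_pow_left ?_ _
    rw [pow_succ']
    gcongr
    omega
  have a7 : Q ≤ Q * R := Nat.le_mul_of_pos_right _ hR1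
  calc E.length + (t₁ + (t₂ + (t₃ + (X.length + 1 + 0)))) ≤ 28 * (Q * R) := by
        have : 10 * Q * R = 10 * (Q * R) := by ring
        omega
    _ ≤ K ^ 2 * (Q * R) := by
        refine Nat.mul_le_mul_right _ ?_
        nlinarith
    _ = K ^ (k + 6 + (k + 1) * (T + 1)) * n := by
        rw [hQ_def, hR]
        ring

theorem length_groundList_le {k T : ℕ} {ε : ℝ} (hε : 0 < ε) (hk : 1 ≤ k) (hn : 1 ≤ n) :
    (groundList n k ε T).length ≤ (T + 4 + ⌈18 / ε⌉₊) * k * n := by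
  have hk' : (1 : ℝ) ≤ k := by exact_mod_cast hk
  have hn' : (1 : ℝ) ≤ n := by exact_mod_cast hn
  have hw : (windowSize n k ε T : ℝ) ≤ ε * ((n : ℝ) + (T + 1) * k) / (3 * k) + 1 :=
    (Nat.ceil_lt_add_one (by positivity)).le
  have hp : (paddedSize n k ε T : ℝ) ≤ 3 * (k : ℝ) * windowSize n k ε T / ε + 1 :=
    (Nat.ceil_lt_add_one (by positivity)).le
  have hc : 18 / ε ≤ (⌈18 / ε⌉₊ : ℝ) := Nat.le_ceil _
  have h1 : 3 * (k : ℝ) * windowSize n k ε T / ε ≤ n + (T + 1) * k + 3 * k / ε := by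
    calc 3 * (k : ℝ) * windowSize n k ε T / ε
        ≤ 3 * (k : ℝ) * (ε * ((n : ℝ) + (T + 1) * k) / (3 * k) + 1) / ε := by gcongr
      _ = n + (T + 1) * k + 3 * k / ε := by field_simp
  have h2 : 3 * k / ε ≤ k * (⌈18 / ε⌉₊ : ℝ) := by
    calc 3 * k / ε = k * (3 / ε) := by ring
      _ ≤ k * (18 / ε) := by gcongr; norm_num
      _ ≤ _ := by gcongr
  have h3 : (paddedSize n k ε T : ℝ) ≤ n + (T + 1) * k + k * (⌈18 / ε⌉₊ : ℝ) + 1 := by linarith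
  have h4 : paddedSize n k ε T ≤ n + (T + 1) * k + k * ⌈18 / ε⌉₊ + 1 := by exact_mod_cast h3
  have h5 : (groundList n k ε T).length ≤ n + paddedSize n k ε T := by
    simp only [groundList, List.length_append, List.length_map, List.length_finRange,
      List.length_range]
    omega
  have h6 : n ≤ k * n := Nat.le_mul_of_pos_left _ hk
  have h7 : ((T + 1) + ⌈18 / ε⌉₊) * k ≤ ((T + 1) + ⌈18 / ε⌉₊) * k * n :=
    Nat.le_mul_of_pos_right _ hn
  nlinarith

theorem eighteen_mul_sq_mul_log_div_le {k : ℕ} {ε : ℝ} (hε : 0 < ε) :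
    18 * (k : ℝ) ^ 2 * Real.log k / ε ≤ (⌈18 / ε⌉₊ * k ^ 3 : ℕ) := by
  have h1 : Real.log k ≤ k := Real.log_le_self (Nat.cast_nonneg _)
  have hc : 18 / ε ≤ (⌈18 / ε⌉₊ : ℝ) := Nat.le_ceil _
  push_cast
  calc 18 * (k : ℝ) ^ 2 * Real.log k / ε = 18 / ε * ((k : ℝ) ^ 2 * Real.log k) := by ring
    _ ≤ ⌈18 / ε⌉₊ * ((k : ℝ) ^ 2 * k) := by gcongr
    _ = _ := by ring

theorem isSoftOLinear_mul_logb (a b C : ℕ) (hC : 1 ≤ C) :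
    IsSoftOLinear fun k => ((a * k + b : ℕ) : ℝ) * Real.logb 2 ((C * k ^ 3 : ℕ) : ℝ) := by
  refine ⟨1, Asymptotics.IsBigO.of_bound (((a : ℝ) + b) * ((Real.log C + 3) / Real.log 2)) ?_⟩
  filter_upwards [Filter.eventually_ge_atTop 3] with k hk
  have hk' : (3 : ℝ) ≤ k := by exact_mod_cast hk
  have hC' : (1 : ℝ) ≤ C := by exact_mod_cast hC
  have hlog : 1 ≤ Real.log k := by
    rw [Real.le_log_iff_exp_le (by linarith)]
    exact Real.exp_one_lt_d9.le.trans (by linarith)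
  have h2 : 0 < Real.log 2 := Real.log_pos (by norm_num)
  have hCl : 0 ≤ Real.log C := Real.log_nonneg hC'
  have hlogb : Real.logb 2 ((C * k ^ 3 : ℕ) : ℝ) = (Real.log C + 3 * Real.log k) / Real.log 2 := by
    rw [Real.logb]
    push_cast
    rw [Real.log_mul (by linarith) (by positivity), Real.log_pow]
    norm_num
  rw [hlogb, Real.norm_of_nonneg (by positivity), Real.norm_of_nonneg (by positivity), pow_one]
  push_cast
  calc ((a : ℝ) * k + b) * ((Real.log C + 3 * Real.log k) / Real.log 2)
      ≤ ((a : ℝ) * k + b * k) * ((Real.log C * Real.log k + 3 * Real.log k) / Real.log 2) := by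
        gcongr
        · exact le_mul_of_one_le_right (Nat.cast_nonneg _) (by linarith)
        · exact le_mul_of_one_le_right hCl hlog
    _ = _ := by ring

theorem two_rpow_mul_logb (p K : ℕ) (hK : 1 ≤ K) :
    (2 : ℝ) ^ ((p : ℝ) * Real.logb 2 (K : ℝ)) = (K : ℝ) ^ p := by
  have hK' : (0 : ℝ) < K := by exact_mod_cast hK
  rw [mul_comm, Real.rpow_mul_natCast (by norm_num),
    Real.rpow_logb (by norm_num) (by norm_num) hK']

/-- The value guarantee holds for every execution, and for every result of the stream. -/
theorem ensures_fptPlus_value (hf : IsSubmodular f) (h0 : ∀ X, 0 ≤ f X) {k T : ℕ} (hT : 1 ≤ T)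
    (ε : ℝ) {O : Finset (Fin n)} (hO : O.card ≤ k) :
    (fptPlus n k ε T).Ensures f fun X _ =>
      (1 - Real.exp (-1)) * (1 - 1 / (T : ℝ)) ^ 2 * f O ≤ f X := by
  have hT' : (1 : ℝ) ≤ T := by exact_mod_cast hT
  have hT1 : 0 ≤ 1 - 1 / (T : ℝ) := by
    rw [sub_nonneg, div_le_one (by linarith)]
    exact hT'
  have hT2 : 1 - 1 / (T : ℝ) ≤ 1 := sub_le_self _ (by positivity)
  have he0 : 0 ≤ 1 - Real.exp (-1) := sub_nonneg.2 (Real.exp_le_one_iff.2 (by norm_num))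
  have he1 : 1 - Real.exp (-1) ≤ 1 := sub_le_self _ (Real.exp_pos _).le
  set O' : Finset (Elt n) := O.map ⟨Sum.inl, Sum.inl_injective⟩
  have hO' : ext f O' = f O := by
    unfold ext
    congr 1
    ext i
    simp [O']
  have hOE : ∀ o ∈ O', o ∈ groundList n k ε T := by
    intro o ho
    obtain ⟨i, -, rfl⟩ := Finset.mem_map.1 ho
    exact List.mem_append_left _ (List.mem_map_of_mem (List.mem_finRange i))
  have hδ : f O / T ≤ ext f O' := by
    rw [hO']
    exact div_le_self (h0 O) hT'
  refine Alg.Ensures.tick_bind ((Alg.ensures_true _).bind fun r t₁ _ =>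
    (Alg.ensures_true _).bind fun I t₂ _ =>
      (ensures_recursive_value hf h0 hT ((Finset.card_map _).trans_le hO) hOE hδ T I).bind
        fun X t₃ ⟨_, hX⟩ => Alg.Ensures.tick_bind (Alg.Ensures.pure ?_))
  rw [apply_realPart (f := f)]
  rcases hX with hX | hX
  · refine le_trans (le_of_eq ?_) hX
    rw [hO']
    ring
  · have h1 : 0 ≤ ext f (O' ∩ I.toFinset) := h0 _
    have h2 : (T : ℝ) * (f O / T) = f O := mul_div_cancel₀ _ (by linarith)
    have h3 : (1 - Real.exp (-1)) * (1 - 1 / (T : ℝ)) ^ 2 * f O ≤ f O :=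
      mul_le_of_le_one_left (h0 O) (mul_le_one₀ he1 (by positivity) (pow_le_one₀ hT1 hT2))
    linarith

theorem ratio_le {T : ℕ} (hT : 20 ≤ T) :
    0.539 ≤ (1 - Real.exp (-1)) * (1 - 1 / (T : ℝ)) ^ 2 := by
  have hT' : (20 : ℝ) ≤ T := by exact_mod_cast hT
  have h1 : 1 / (T : ℝ) ≤ 1 / 20 := one_div_le_one_div_of_le (by norm_num) hT'
  have h2 : Real.exp (-1) ≤ 0.37 := Real.exp_neg_one_lt_d9.le.trans (by norm_num)
  calc (0.539 : ℝ) ≤ (1 - 0.37) * (1 - 1 / 20) ^ 2 := by norm_num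
    _ ≤ _ := by gcongr; linarith

end Total

end SubmodularFPT

end

theorem mainTheorem1 :
    -- for all large `T` and all small `ε`, the expected value is at least `0.539` times the optimum
    (∃ T₀ : ℕ, ∃ ε₀ : ℝ, 0 < ε₀ ∧ ε₀ ≤ 1 ∧
      ∀ T : ℕ, T₀ ≤ T → ∀ ε : ℝ, 0 < ε → ε ≤ ε₀ →
        ∀ n k : ℕ, 1 ≤ n → 1 ≤ k →
          ∀ f : Finset (Fin n) → ℝ, (∀ X, 0 ≤ f X) → SubmodularFPT.IsSubmodular f →
            ∀ O : Finset (Fin n), O.card ≤ k →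
              ENNReal.ofReal (0.539 * f O) ≤
                (SubmodularFPT.fptPlus n k ε T).expectedValue f) ∧
    -- for all constants `T` and `ε`, every execution outputs a feasible solution and makes
    -- `2 ^ Õ(k) * n` queries and steps
    (∀ T : ℕ, ∀ ε : ℝ, 0 < ε → ε ≤ 1 →
      ∃ g : ℕ → ℝ, SubmodularFPT.IsSoftOLinear g ∧
        ∀ n k : ℕ, 1 ≤ n → 1 ≤ k →
          ∀ f : Finset (Fin n) → ℝ,
            ∀ o ∈ ((SubmodularFPT.fptPlus n k ε T).run f).support,
              o.output.card ≤ k ∧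
              (o.queries : ℝ) ≤ (2 : ℝ) ^ g k * n ∧
              (o.time : ℝ) ≤ (2 : ℝ) ^ g k * n) := by
  open SubmodularFPT in
  constructor
  · refine ⟨20, 1, one_pos, le_rfl, fun T hT ε _ _ n k _ _ f h0 hf O hO => ?_⟩
    refine Alg.le_expectedValue ((ensures_fptPlus_value hf h0 (by omega) ε hO).mono
      fun X _ hX => le_trans ?_ hX)
    exact mul_le_mul_of_nonneg_right (ratio_le hT) (h0 O)
  · intro T ε hε hε1
    set c := ⌈18 / ε⌉₊
    -- `C * k ^ 3` bounds `T`, the lengths of the lists in the recursion, and the length of the ground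
    -- list divided by `n`.
    set C := 100 + 2 * c + T * T + T with hC
    refine ⟨_, isSoftOLinear_mul_logb (T + 2) (T + 7) C (by omega), fun n k hn hk f o ho => ?_⟩
    have hk3 : k ≤ k ^ 3 := Nat.le_self_pow (by norm_num) k
    have hK : C * k ^ 3 = 100 * k ^ 3 + 2 * (c * k ^ 3) + T * T * k ^ 3 + T * k ^ 3 := by
      rw [hC]
      ring
    have h1 : T ≤ T * k ^ 3 := Nat.le_mul_of_pos_right _ (by omega)
    have h2 : T * (T * k) ≤ T * T * k ^ 3 := by
      rw [← mul_assoc]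
      exact Nat.mul_le_mul_left _ hk3
    have hM : (T + 4 + c) * k ≤ C * k ^ 3 := Nat.mul_le_mul (by omega) hk3
    obtain ⟨hcard, htime⟩ := (ensures_fptPlus_cost (f := f) (h := c * k ^ 3) (K := C * k ^ 3) hε1 hn (by omega)
      (by omega) (eighteen_mul_sq_mul_log_div_le hε) (by omega) (by omega)
      ((length_groundList_le hε hk hn).trans (Nat.mul_le_mul_right _ hM))).of_mem_support o ho
    have hp : k + 6 + (k + 1) * (T + 1) = (T + 2) * k + (T + 7) := by ring
    rw [two_rpow_mul_logb _ _ (by omega), ← hp]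
    have htime' : (o.time : ℝ) ≤ ((C * k ^ 3 : ℕ) : ℝ) ^ (k + 6 + (k + 1) * (T + 1)) * n := by
      exact_mod_cast htime
    refine ⟨hcard, le_trans ?_ htime', htime'⟩
    exact_mod_cast Alg.queries_le_time _ o ho
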